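/- Let $\mathbb K\in\{\mathbb R,\mathbb C\}$ and let $X$ be a separable infinite-dimensional Fréchet space over $\mathbb K$ (a complete metrizable locally convex topological vector space). Let $\omega=\mathbb K^{\mathbb Z_+}$ be the space of all scalar sequences with the topology of coordinatewise convergence. For an abelian monoid $A$ an operator semigroup $\{T_t\}_{t\in A}$ on $X$ is a family of continuous linear operators $T_t:X\to X$ with $T_0=I$ and $T_{s+t}=T_tT_s$ for all $s,t\in A$; if $A$ is a group, it is called an operator group. Then the following are equivalent: 1. for each integer $k\ge 1$ there is an operator group $\{T_t\}_{t\in\mathbb R^k}$ on $X$ that is - uniformly continuous: there is a neighborhood $U$ of zero in $X$ such that, for every sequence $t_n\to t$ in $\mathbb R^k$, $T_{t_n}x\to T_tx$ uniformly for $x\in U$, and - mixing: for any non-empty open $U,V\subseteq X$ there is $r>0$ such that $T_t(U)\cap V\neq\varnothing$ for all $t\in\mathbb R^k$ with Euclidean norm $|t|>r$; 2. there is an operator semigroup $\{T_t\}_{t\in\mathbb R_+}$ on $X$, where $\mathbb R_+=[0,\infty)$, that is - strongly continuous: $t\mapsto T_tx$ is continuous from $\mathbb R_+$ to $X$ for each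 $x\in X$, and - supercyclic: there is $x\in X$ such that $\{zT_tx: z\in\mathbb K,\ t\in\mathbb R_+\}$ is dense in $X$; 3. $X$ is not isomorphic to $\omega$ (as a topological vector space). -/

import Mathlib

open Filter Topology

/-- A family of maps is universal if some point has a dense orbit under it. -/
def IsUniversalFamily {ι X Y : Type*} [TopologicalSpace Y] (F : ι → X → Y) : Prop :=
  ∃ x : X, Dense (Set.range fun i => F i x)

/-- An operator semigroup on `X` indexed by an abelian monoid `A` (written additively):
a family of continuous linear operators with `T 0 = I` and `T (s + t) = T t ∘ T s`.
When `A` is a group, this is an operator group. -/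
structure IsOperatorSemigroup {𝕜 X A : Type*} [RCLike 𝕜] [AddCommGroup X] [Module 𝕜 X]
    [TopologicalSpace X] [AddCommMonoid A] (T : A → X →L[𝕜] X) : Prop where
  map_zero : T 0 = ContinuousLinearMap.id 𝕜 X
  map_add : ∀ s t : A, T (s + t) = (T t).comp (T s)

/-- Strong continuity: every orbit map `t ↦ T t x` is continuous. -/
def IsStronglyContinuousFamily {𝕜 X A : Type*} [RCLike 𝕜] [AddCommGroup X] [Module 𝕜 X]
    [TopologicalSpace X] [TopologicalSpace A] (T : A → X →L[𝕜] X) : Prop :=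
  ∀ x : X, Continuous fun t => T t x

/-- Uniform continuity: there is one neighbourhood `U` of zero such that `T (u n) x` converges
to `T t x` uniformly for `x ∈ U`, whenever the sequence `u` converges to `t`. -/
def IsUniformlyContinuousFamily {𝕜 X A : Type*} [RCLike 𝕜] [AddCommGroup X] [Module 𝕜 X]
    [UniformSpace X] [TopologicalSpace A] (T : A → X →L[𝕜] X) : Prop :=
  ∃ U ∈ 𝓝 (0 : X), ∀ (u : ℕ → A) (t : A), Tendsto u atTop (𝓝 t) →
    TendstoUniformlyOn (fun n x => T (u n) x) (fun x => T t x) atTop U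

/-- Mixing: for all non-empty open `U`, `V`, there is `r > 0` such that `T t U` meets `V`
as soon as `‖t‖ > r`. -/
def IsMixingFamily {𝕜 X A : Type*} [RCLike 𝕜] [AddCommGroup X] [Module 𝕜 X]
    [TopologicalSpace X] [Norm A] (T : A → X →L[𝕜] X) : Prop :=
  ∀ U V : Set X, IsOpen U → U.Nonempty → IsOpen V → V.Nonempty →
    ∃ r : ℝ, 0 < r ∧ ∀ t : A, r < ‖t‖ → (T t '' U ∩ V).Nonempty

/-- Supercyclicity: the family of all scalar multiples `z • T t` is universal. -/
def IsSupercyclicFamily {𝕜 X A : Type*} [RCLike 𝕜] [AddCommGroup X] [Module 𝕜 X]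
    [TopologicalSpace X] (T : A → X →L[𝕜] X) : Prop :=
  IsUniversalFamily fun (p : 𝕜 × A) (x : X) => p.1 • T p.2 x

set_option linter.unusedSectionVars false

/-! From mixing groups to supercyclic semigroups: restrict a mixing group over `ℝ` to the half-line;
Birkhoff's Baire category argument gives a dense orbit.

From `X ≇ ω` to mixing groups: if the kernel of every continuous seminorm had finite codimension,
the dual would have countable dimension and evaluation at a basis of it would identify `X` with `ω`.
So some continuous seminorm `p` has a kernel of infinite codimension, and there is a biorthogonal
system with dense span whose functionals are all `p`-bounded (`exists_biorthogonal`). Indexed by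
multi-indices and rescaled, it gives a map `Ψ` from polynomials onto a dense subspace of `X` that
intertwines the partial derivatives with operators `J ∘ F j` factoring through `ℓ^∞`
(`exists_factors_of_biorthogonal`). The factorization makes the exponential series converge, and on
polynomials the exponential is translation. Mixing thus reduces to algebra: for large `t`, find a
polynomial near `u` whose translate by `t` is near `v` (`exists_interpolating_polynomials`).

No supercyclic semigroup on `ω`: by Banach–Steinhaus each functional lies in a finite-dimensional
space of functionals invariant under the semigroup (`exists_finiteDimensional_invariant`). Three
coordinates give a supercyclic semigroup on a finite-dimensional quotient of dimension at least 3.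
But in finite dimension `n` the generated commutative algebra satisfies `‖A‖ ^ n ≤ C * ‖det A‖`,
because the times with a good ratio recur with bounded gaps (`exists_norm_pow_le_det`). Hence it is
a field over `𝕜`, and its dimension, which is `n`, is at most 2. -/

open scoped ComplexOrder in
theorem polynormableSpace_of_locallyConvexSpace_real (𝕜 X : Type*) [RCLike 𝕜] [AddCommGroup X]
    [Module 𝕜 X] [Module ℝ X] [IsScalarTower ℝ 𝕜 X] [TopologicalSpace X] [IsTopologicalAddGroup X]
    [ContinuousSMul 𝕜 X] [LocallyConvexSpace ℝ X] : PolynormableSpace 𝕜 X := by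
  have hR : ContinuousSMul ℝ X := IsScalarTower.continuousSMul 𝕜
  have : LocallyConvexSpace 𝕜 X := by
    rw [locallyConvexSpace_iff_exists_convex_subset]
    intro x U hU
    obtain ⟨S, hS, hc, hSU⟩ :=
      (locallyConvexSpace_iff_exists_convex_subset ℝ X).1 inferInstance x U hU
    -- In the order on `𝕜` the nonnegative scalars are exactly the nonnegative reals, so both
    -- convexities agree.
    exact ⟨S, hS, convex_of_nonneg_surjective_algebraMap _
        (fun _ => RCLike.nonneg_iff_exists_ofReal.mp) hc, hSU⟩
  infer_instance

/-! ### Continuous seminorms and Hahn–Banach. -/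

section Seminorms

variable {𝕜 X : Type*} [RCLike 𝕜] [AddCommGroup X] [Module 𝕜 X] [TopologicalSpace X]
  [IsTopologicalAddGroup X] [ContinuousSMul 𝕜 X] [PolynormableSpace 𝕜 X]

variable (𝕜) in
theorem exists_continuous_seminorm_ball_subset {U : Set X} (hU : U ∈ 𝓝 (0 : X)) :
    ∃ p : Seminorm 𝕜 X, Continuous p ∧ p.ball 0 1 ⊆ U := by
  obtain ⟨s, r, hr, hs⟩ := ((PolynormableSpace.withSeminorms 𝕜 X).mem_nhds_iff 0 U).1 hU
  refine ⟨r⁻¹.toNNReal • s.sup fun p : {p : Seminorm 𝕜 X // Continuous p} => p.1, ?_, ?_⟩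
  · refine Continuous.const_smul ?_ _
    refine Seminorm.continuous_of_le (q := ∑ i ∈ s, i.1) ?_ (Seminorm.finset_sup_le_sum _ s)
    have h : ⇑(∑ i ∈ s, i.1) = fun x => ∑ i ∈ s, i.1 x := by
      ext x
      simp
    rw [h]
    exact continuous_finsetSum s fun i _ => i.2
  · refine subset_trans (fun x hx => ?_) hs
    rw [Seminorm.mem_ball_zero] at hx ⊢
    have h2 : r⁻¹ * (s.sup fun p : {p : Seminorm 𝕜 X // Continuous p} => p.1) x < 1 := by
      simpa [smul_apply, NNReal.smul_def, Real.coe_toNNReal _ (inv_pos.2 hr).le] using hx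
    rwa [inv_mul_lt_one₀ hr] at h2

theorem Seminorm.le_mul_of_ball_subset {p q : Seminorm 𝕜 X} {c : ℝ} (hc : 0 < c)
    (h : q.ball 0 1 ⊆ p.ball 0 c) (x : X) : p x ≤ c * q x := by
  -- Normalizing by `q x + ε / c` avoids dividing by `q x`, which may vanish.
  refine le_of_forall_pos_le_add fun ε hε => ?_
  have hq : 0 ≤ q x := apply_nonneg q x
  have hpos : 0 < q x + ε / c := by positivity
  have hy : ((q x + ε / c : ℝ) : 𝕜)⁻¹ • x ∈ q.ball 0 1 := by
    rw [Seminorm.mem_ball_zero, map_smul_eq_mul, norm_inv, RCLike.norm_ofReal, abs_of_pos hpos,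
      inv_mul_lt_one₀ hpos]
    have : 0 < ε / c := by positivity
    linarith
  have := h hy
  rw [Seminorm.mem_ball_zero, map_smul_eq_mul, norm_inv, RCLike.norm_ofReal, abs_of_pos hpos,
    inv_mul_lt_iff₀ hpos] at this
  have e : (q x + ε / c) * c = c * q x + ε := by field_simp
  linarith

variable (𝕜 X) in
theorem exists_seq_continuous_seminorm [FirstCountableTopology X] :
    ∃ q : ℕ → Seminorm 𝕜 X, (∀ n, Continuous (q n)) ∧
      ∀ p : Seminorm 𝕜 X, Continuous p → ∃ n, ∀ x, p x ≤ q n x := by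
  obtain ⟨U, hU⟩ := (𝓝 (0 : X)).exists_antitone_basis
  choose q hq hqU using fun n => exists_continuous_seminorm_ball_subset 𝕜 (hU.1.mem_of_mem (i := n) trivial)
  refine ⟨q, hq, fun p hp => ?_⟩
  obtain ⟨n, -, hn⟩ := hU.1.mem_iff.1 (p.ball_mem_nhds hp one_pos)
  exact ⟨n, fun x => by
    simpa using Seminorm.le_mul_of_ball_subset one_pos ((hqU n).trans hn) x⟩

theorem exists_seminorm_bound (f : X →L[𝕜] 𝕜) :
    ∃ p : Seminorm 𝕜 X, Continuous p ∧ ∀ x, ‖f x‖ ≤ p x :=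
  ⟨f.toSeminorm, f.continuous.norm, fun _ => le_rfl⟩

/-- Hahn–Banach with dominating seminorm `p`, starting from the line through `x`. -/
theorem exists_dual_of_seminorm_ne_zero {p : Seminorm 𝕜 X} (hp : Continuous p) {x : X}
    (hx : p x ≠ 0) : ∃ g : X →L[𝕜] 𝕜, g x = 1 ∧ ∃ C, ∀ y, ‖g y‖ ≤ C * p y := by
  have hx0 : x ≠ 0 := fun h => hx (by simp [h])
  let f : Module.Dual 𝕜 (Submodule.span 𝕜 {x}) :=
    ((p x : 𝕜)) • (LinearEquiv.toSpanNonzeroSingleton 𝕜 X x hx0).symm.toLinearMap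
  obtain ⟨g, hg, hgp⟩ := Module.Dual.exists_continuous_extension_of_le_seminorm _ f hp (by
    intro y
    obtain ⟨c, rfl⟩ := (LinearEquiv.toSpanNonzeroSingleton 𝕜 X x hx0).surjective y
    have h : f (LinearEquiv.toSpanNonzeroSingleton 𝕜 X x hx0 c) = p x * c := by
      simp only [f, LinearMap.smul_apply, LinearEquiv.coe_coe, LinearEquiv.symm_apply_apply,
        smul_eq_mul]
    rw [h]
    simp [map_smul_eq_mul, mul_comm, abs_of_nonneg (apply_nonneg p x)])
  have hgx : g x = p x := by
    have := hg (LinearEquiv.toSpanNonzeroSingleton 𝕜 X x hx0 1)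
    rw [show f (LinearEquiv.toSpanNonzeroSingleton 𝕜 X x hx0 1) = p x by
      simp only [f, LinearMap.smul_apply, LinearEquiv.coe_coe, LinearEquiv.symm_apply_apply,
        smul_eq_mul, mul_one]] at this
    simpa using this
  refine ⟨(p x : 𝕜)⁻¹ • g, by simp [hgx, hx], (p x)⁻¹, fun y => ?_⟩
  simp only [smul_apply, norm_smul, norm_inv, RCLike.norm_ofReal,
    abs_of_nonneg (apply_nonneg p x)]
  gcongr
  exact hgp y

theorem tendsto_nhds_of_seminorm {α : Type*} {l : Filter α} {u : α → X} {a : X}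
    (h : ∀ p : Seminorm 𝕜 X, Continuous p → Tendsto (fun i => p (u i - a)) l (𝓝 0)) :
    Tendsto u l (𝓝 a) := by
  rw [(PolynormableSpace.withSeminorms 𝕜 X).tendsto_nhds]
  intro p ε hε
  exact (h p.1 p.2).eventually (gt_mem_nhds hε)

end Seminorms

/-! ### Biorthogonal systems controlled by one seminorm. -/

section Biorthogonal

variable {𝕜 X : Type*} [RCLike 𝕜] [AddCommGroup X] [Module 𝕜 X] [TopologicalSpace X]
  [IsTopologicalAddGroup X] [ContinuousSMul 𝕜 X] [PolynormableSpace 𝕜 X]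

/-- The seminorm `p` has a kernel of finite codimension, complemented by means of finitely many
continuous functionals. -/
def Seminorm.HasFiniteRank (p : Seminorm 𝕜 X) : Prop :=
  ∃ (m : ℕ) (f : Fin m → X →L[𝕜] 𝕜) (x : Fin m → X), ∀ y, p (y - ∑ i, f i y • x i) = 0

/-- Continuous projections of finite corank that are bounded for the seminorm `p`. -/
structure IsFiniteCorankProjection (p : Seminorm 𝕜 X) (P : X →L[𝕜] X) : Prop where
  idem : ∀ y, P (P y) = P y
  bound : ∃ C, 0 ≤ C ∧ ∀ y, p (P y) ≤ C * p y
  corank : ∃ (m : ℕ) (f : Fin m → X →L[𝕜] 𝕜) (x : Fin m → X), ∀ y, P y = y - ∑ i, f i y • x i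

theorem IsFiniteCorankProjection.id (p : Seminorm 𝕜 X) :
    IsFiniteCorankProjection p (ContinuousLinearMap.id 𝕜 X) where
  idem _ := rfl
  bound := ⟨1, zero_le_one, by simp⟩
  corank := ⟨0, 0, 0, by simp⟩

theorem IsFiniteCorankProjection.sub {p : Seminorm 𝕜 X} {P : X →L[𝕜] X}
    (hP : IsFiniteCorankProjection p P) {x : X} {f : X →L[𝕜] 𝕜} (hx : P x = x)
    (hf : ∀ y, f (P y) = f y) (hfx : f x = 1) (hfp : ∃ C, 0 ≤ C ∧ ∀ y, ‖f y‖ ≤ C * p y) :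
    IsFiniteCorankProjection p (P - f.smulRight x) where
  idem y := by simp [hx, hf, hfx, hP.idem]
  bound := by
    obtain ⟨C, hC0, hC⟩ := hP.bound
    obtain ⟨D, hD0, hD⟩ := hfp
    refine ⟨C + D * p x, by positivity, fun y => ?_⟩
    calc p ((P - f.smulRight x) y) ≤ p (P y) + p (f y • x) := by
          simpa using map_sub_le_add p (P y) (f y • x)
      _ ≤ C * p y + D * p y * p x := by
          rw [map_smul_eq_mul]
          gcongr
          · exact hC y
          · exact hD y
      _ = _ := by ring
  corank := by
    obtain ⟨m, g, z, h⟩ := hP.corank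
    refine ⟨m + 1, Fin.cons f g, Fin.cons x z, fun y => ?_⟩
    simp [Fin.sum_univ_succ, h]
    abel

/-- Infinite rank of `p` prevents the range of `P` from lying in `ker p`, so `P y` can be perturbed
inside that range to make `p` nonzero. A Hahn–Banach functional composed with `P` stays `p`-bounded
because `P` is. -/
theorem IsFiniteCorankProjection.exists_step {p : Seminorm 𝕜 X} (hp : Continuous p)
    (hfin : ¬ p.HasFiniteRank) {P : X →L[𝕜] X} (hP : IsFiniteCorankProjection p P) (y : X)
    {U : Set X} (hU : U ∈ 𝓝 (0 : X)) :
    ∃ xf : X × (X →L[𝕜] 𝕜), P xf.1 = xf.1 ∧ (∀ z, xf.2 (P z) = xf.2 z) ∧ xf.2 xf.1 = 1 ∧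
      (∃ C, 0 ≤ C ∧ ∀ z, ‖xf.2 z‖ ≤ C * p z) ∧ xf.1 - P y ∈ U := by
  obtain ⟨x, hPx, hpx, hxU⟩ : ∃ x, P x = x ∧ p x ≠ 0 ∧ x - P y ∈ U := by
    by_cases hy : p (P y) = 0
    · obtain ⟨m, g, w, h⟩ := hP.corank
      obtain ⟨z, hz⟩ : ∃ z, p (P z) ≠ 0 := by
        by_contra! hcon
        exact hfin ⟨m, g, w, fun z => by rw [← h]; exact hcon z⟩
      have hlim : Tendsto (fun c : 𝕜 => c • P z) (𝓝[≠] 0) (𝓝 0) := by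
        have : Continuous fun c : 𝕜 => c • P z := by fun_prop
        simpa using (this.tendsto 0).mono_left nhdsWithin_le_nhds
      obtain ⟨c, hcU, hc⟩ := ((hlim.eventually_mem hU).and eventually_mem_nhdsWithin).exists
      refine ⟨P y + c • P z, by simp [hP.idem], ?_, by simpa using hcU⟩
      have h1 : p (c • P z) ≤ p (P y + c • P z) + p (P y) := by
        simpa using map_sub_le_add p (P y + c • P z) (P y)
      have h2 : 0 < p (c • P z) := by
        rw [map_smul_eq_mul]
        exact mul_pos (norm_pos_iff.2 hc) ((apply_nonneg p _).lt_of_ne' hz)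
      rw [hy, add_zero] at h1
      exact (h2.trans_le h1).ne'
    · exact ⟨P y, hP.idem y, hy, by simpa using mem_of_mem_nhds hU⟩
  obtain ⟨g, hgx, C, hC⟩ := exists_dual_of_seminorm_ne_zero hp hpx
  obtain ⟨D, hD0, hD⟩ := hP.bound
  refine ⟨⟨x, g.comp P⟩, hPx, fun z => by simp [hP.idem], by simp [hPx, hgx], ?_, hxU⟩
  refine ⟨|C| * D, by positivity, fun z => ?_⟩
  calc ‖g (P z)‖ ≤ C * p (P z) := hC _
    _ ≤ |C| * (D * p z) := by
        gcongr
        · exact le_abs_self C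
        · exact hD z
    _ = _ := by ring

/-- A Gram–Schmidt process: each new pair is split off by `P (n + 1) = P n - f n ⊗ x n`. Density of
the span is secured by choosing `x n` close to `P n (y n)`. -/
theorem exists_biorthogonal [FirstCountableTopology X] [TopologicalSpace.SeparableSpace X]
    {p : Seminorm 𝕜 X} (hp : Continuous p) (hfin : ¬ p.HasFiniteRank) :
    ∃ (x : ℕ → X) (f : ℕ → X →L[𝕜] 𝕜), (∀ m n, f m (x n) = if m = n then 1 else 0) ∧
      (∀ n, ∃ C, 0 ≤ C ∧ ∀ y, ‖f n y‖ ≤ C * p y) ∧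
      Dense (Submodule.span 𝕜 (Set.range x) : Set X) := by
  obtain ⟨U, hU⟩ := (𝓝 (0 : X)).exists_antitone_basis
  -- Unpairing makes each dense vector recur infinitely often, hence with arbitrarily small errors.
  let y : ℕ → X := fun n => TopologicalSpace.denseSeq X n.unpair.1
  choose xf h1 h2 h3 h4 h5 using fun (n : ℕ) (P : {P // IsFiniteCorankProjection p P}) =>
    P.2.exists_step hp hfin (y n) (hU.1.mem_of_mem (i := n) trivial)
  let P : ℕ → {P // IsFiniteCorankProjection p P} := fun n => Nat.rec ⟨_, .id p⟩
    (fun n P => ⟨P.1 - (xf n P).2.smulRight (xf n P).1, P.2.sub (h1 n P) (h2 n P) (h3 n P) (h4 n P)⟩) n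
  let x : ℕ → X := fun n => (xf n (P n)).1
  let f : ℕ → X →L[𝕜] 𝕜 := fun n => (xf n (P n)).2
  have hP0 : ∀ z, (P 0).1 z = z := fun _ => rfl
  have hPs : ∀ n z, (P (n + 1)).1 z = (P n).1 z - f n z • x n := fun _ _ => rfl
  have hx : ∀ n, (P n).1 (x n) = x n := fun n => h1 n (P n)
  have hf : ∀ n z, f n ((P n).1 z) = f n z := fun n => h2 n (P n)
  have hfx : ∀ n, f n (x n) = 1 := fun n => h3 n (P n)
  have hcomp : ∀ m n, m ≤ n → ∀ z,
      (P n).1 ((P m).1 z) = (P n).1 z ∧ (P m).1 ((P n).1 z) = (P n).1 z := by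
    intro m n hmn
    induction n, hmn using Nat.le_induction with
    | base => exact fun z => ⟨(P m).2.idem z, (P m).2.idem z⟩
    | succ n hmn ih =>
      intro z
      refine ⟨?_, ?_⟩
      · rw [hPs, hPs, (ih z).1, ← hf n ((P m).1 z), (ih z).1, hf]
      · rw [hPs, map_sub, map_smul, (ih z).2, ← hx n, (ih _).2]
  have hfP : ∀ m n, m < n → ∀ z, f m ((P n).1 z) = 0 := by
    intro m n hmn z
    rw [← (hcomp (m + 1) n hmn z).2, hPs, map_sub, map_smul, hf, hfx]
    simp
  have hPx : ∀ m n, m < n → (P n).1 (x m) = 0 := by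
    intro m n hmn
    rw [← (hcomp (m + 1) n hmn _).1, hPs, hx, hfx]
    simp
  refine ⟨x, f, fun m n => ?_, fun n => h4 n (P n), ?_⟩
  · rcases lt_trichotomy m n with h | rfl | h
    · rw [if_neg h.ne, ← hx, hfP m n h]
    · simp [hfx]
    · rw [if_neg h.ne', ← hf, hPx n m h, map_zero]
  · have hspan : ∀ n z, z - (P n).1 z ∈ Submodule.span 𝕜 (Set.range x) := by
      intro n z
      induction n with
      | zero => simp [hP0]
      | succ n ih =>
        rw [hPs, ← sub_add]
        exact add_mem ih (Submodule.smul_mem _ _ (Submodule.subset_span ⟨n, rfl⟩))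
    rw [dense_iff_inter_open]
    rintro W hW hWne
    obtain ⟨m, hm⟩ := (TopologicalSpace.denseRange_denseSeq X).exists_mem_open hW hWne
    have hnh : (fun z => TopologicalSpace.denseSeq X m + z) ⁻¹' W ∈ 𝓝 (0 : X) := by
      refine (by fun_prop : Continuous fun z => TopologicalSpace.denseSeq X m + z).continuousAt ?_
      simpa using hW.mem_nhds hm
    obtain ⟨N, -, hN⟩ := hU.1.mem_iff.1 hnh
    -- With `y` the dense vector and `n` the chosen stage, `y + (x n - P n y) = (y - P n y) + x n`
    -- lies in the span and in `W`.
    have h6 := hN (hU.2 (Nat.right_le_pair m N) (h5 (Nat.pair m N) (P (Nat.pair m N))))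
    simp only [y, Nat.unpair_pair, Set.mem_preimage] at h6
    refine ⟨_, h6, ?_⟩
    have hxm : x (Nat.pair m N) ∈ Submodule.span 𝕜 (Set.range x) := Submodule.subset_span ⟨_, rfl⟩
    have h7 := add_mem (hspan (Nat.pair m N) (TopologicalSpace.denseSeq X m)) hxm
    convert! h7 using 1
    simp only [x]
    abel

end Biorthogonal

/-! ### Finite rank of all continuous seminorms characterizes `ω`. -/

section FiniteRank

variable {𝕜 X : Type*} [RCLike 𝕜] [AddCommGroup X] [Module 𝕜 X] [UniformSpace X]
  [IsUniformAddGroup X] [ContinuousSMul 𝕜 X] [PolynormableSpace 𝕜 X]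

variable (𝕜) in
theorem eq_zero_of_forall_dual_eq_zero [T2Space X] {y : X}
    (h : ∀ g : X →L[𝕜] 𝕜, g y = 0) : y = 0 := by
  by_contra hy
  obtain ⟨p, hp, hpU⟩ := exists_continuous_seminorm_ball_subset 𝕜
    (isOpen_compl_singleton.mem_nhds (x := (0 : X)) (Ne.symm hy))
  have hpy : p y ≠ 0 := fun h0 => hpU (show y ∈ p.ball 0 1 by simp [h0]) rfl
  obtain ⟨g, hg, -⟩ := exists_dual_of_seminorm_ne_zero hp hpy
  simp [h g] at hg

/-- A nonzero functional on `𝕜^ι` vanishing on the joint range would be a linear relation among the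
`g i`. -/
theorem exists_forall_apply_eq_of_linearIndependent {E ι : Type*} [AddCommGroup E] [Module 𝕜 E]
    [Fintype ι] {g : ι → Module.Dual 𝕜 E} (hg : LinearIndependent 𝕜 g) (a : ι → 𝕜) :
    ∃ y, ∀ i, g i y = a i := by
  suffices h : LinearMap.range (LinearMap.pi g) = ⊤ by
    obtain ⟨y, hy⟩ := LinearMap.range_eq_top.1 h a
    exact ⟨y, fun i => congrFun hy i⟩
  by_contra hne
  obtain ⟨f, hf0, hf⟩ := Submodule.exists_le_ker_of_lt_top _ (lt_top_iff_ne_top.2 hne)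
  classical
  have hfe : ∀ w, f w = ∑ i, w i * f (Pi.single i 1) := fun w => by
    have h1 : w = ∑ i, w i • Pi.single i (1 : 𝕜) := by
      ext j
      simp [Finset.sum_apply, Pi.single_apply]
    conv_lhs => rw [h1]
    simp
  have h0 : ∑ i, f (Pi.single i 1) • g i = 0 := by
    ext y
    have := hf ⟨y, rfl⟩
    rw [LinearMap.mem_ker, hfe] at this
    simpa [mul_comm] using this
  have hc := Fintype.linearIndependent_iff.1 hg _ h0
  exact hf0 (LinearMap.ext fun w => by rw [hfe]; simp [hc])

/-- A functional bounded by `q n` kills `ker (q n)`, so it is a combination of the finitely many `f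
n i`. A cofinal sequence of seminorms therefore yields a countable spanning set of the dual. -/
theorem exists_linearIndependent_seq_dual [FirstCountableTopology X] [T2Space X]
    (hfin : ∀ p : Seminorm 𝕜 X, Continuous p → p.HasFiniteRank) (hX : ¬ FiniteDimensional 𝕜 X) :
    ∃ g : ℕ → X →L[𝕜] 𝕜, LinearIndependent 𝕜 g ∧ Submodule.span 𝕜 (Set.range g) = ⊤ := by
  obtain ⟨q, hq, hqd⟩ := exists_seq_continuous_seminorm 𝕜 X
  choose m f x hfx using fun n => hfin (q n) (hq n)
  let S : Set (X →L[𝕜] 𝕜) := ⋃ n, Set.range (f n)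
  have hS : S.Countable := Set.countable_iUnion fun n => Set.countable_range _
  have hspan : Submodule.span 𝕜 S = ⊤ := by
    refine eq_top_iff.2 fun h _ => ?_
    obtain ⟨p, hp, hhp⟩ := exists_seminorm_bound h
    obtain ⟨n, hn⟩ := hqd p hp
    have he : h = ∑ i, h (x n i) • f n i := by
      ext y
      have h1 : h (y - ∑ i, f n i y • x n i) = 0 :=
        norm_le_zero_iff.1 (((hhp _).trans (hn _)).trans_eq (hfx n y))
      rw [map_sub, sub_eq_zero] at h1
      simpa [mul_comm] using h1
    rw [he]
    exact Submodule.sum_mem _ fun i _ => Submodule.smul_mem _ _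
      (Submodule.subset_span (Set.mem_iUnion.2 ⟨n, i, rfl⟩))
  obtain ⟨b, hbS, hb, hli⟩ := exists_linearIndependent 𝕜 S
  rw [hspan] at hb
  have hbinf : Infinite b := by
    by_contra hbf
    have : Finite b := not_infinite_iff_finite.1 hbf
    refine hX (FiniteDimensional.of_injective (LinearMap.pi fun i : b => (i.1 : X →ₗ[𝕜] 𝕜)) ?_)
    refine (injective_iff_map_eq_zero _).2 fun y hy => eq_zero_of_forall_dual_eq_zero 𝕜 fun g => ?_
    have hg : g ∈ Submodule.span 𝕜 b := hb ▸ Submodule.mem_top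
    induction hg using Submodule.span_induction with
    | mem g hg => exact congrFun hy ⟨g, hg⟩
    | zero => rfl
    | add g h _ _ h1 h2 => simp [h1, h2]
    | smul c g _ h1 => simp [h1]
  have : Countable b := (hS.mono hbS).to_subtype
  obtain ⟨e⟩ := nonempty_equiv_of_countable (α := ℕ) (β := b)
  refine ⟨fun n => (e n).1, hli.comp e e.injective, ?_⟩
  rw [← hb]
  congr 1
  ext g
  exact ⟨fun ⟨n, hn⟩ => hn ▸ (e n).2, fun hg => ⟨e.symm ⟨g, hg⟩, by simp⟩⟩

/-- The isomorphism is evaluation at a basis of the dual. It is inducing because each seminorm is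
controlled by finitely many functionals, each factoring through it; its range is closed by
completeness and dense by independence. -/
theorem nonempty_equiv_pi_of_hasFiniteRank [FirstCountableTopology X] [T2Space X] [CompleteSpace X]
    (hfin : ∀ p : Seminorm 𝕜 X, Continuous p → p.HasFiniteRank) (hX : ¬ FiniteDimensional 𝕜 X) :
    Nonempty (X ≃L[𝕜] (ℕ → 𝕜)) := by
  obtain ⟨g, hli, hspan⟩ := exists_linearIndependent_seq_dual hfin hX
  let Φ : X →L[𝕜] (ℕ → 𝕜) := ContinuousLinearMap.pi g
  have hfac : ∀ h : X →L[𝕜] 𝕜, ∃ L : (ℕ → 𝕜) →L[𝕜] 𝕜, ∀ y, h y = L (Φ y) := by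
    intro h
    have hh : h ∈ Submodule.span 𝕜 (Set.range g) := hspan ▸ Submodule.mem_top
    induction hh using Submodule.span_induction with
    | mem h hh =>
      obtain ⟨n, rfl⟩ := hh
      exact ⟨ContinuousLinearMap.proj n, fun y => rfl⟩
    | zero => exact ⟨0, by simp⟩
    | add h k _ _ h1 h2 =>
      obtain ⟨L, hL⟩ := h1
      obtain ⟨M, hM⟩ := h2
      exact ⟨L + M, by simp [hL, hM]⟩
    | smul c h _ h1 =>
      obtain ⟨L, hL⟩ := h1
      exact ⟨c • L, by simp [hL]⟩
  have hinj : Function.Injective Φ := by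
    refine (injective_iff_map_eq_zero _).2 fun y hy => eq_zero_of_forall_dual_eq_zero 𝕜 fun h => ?_
    obtain ⟨L, hL⟩ := hfac h
    rw [hL, hy, map_zero]
  have hind : IsInducing Φ := by
    refine isInducing_iff_nhds.2 fun z => ?_
    refine le_antisymm (Φ.continuous.tendsto z).le_comap fun U hU => ?_
    have hU0 : (fun y => z + y) ⁻¹' U ∈ 𝓝 (0 : X) :=
      (by fun_prop : Continuous fun y : X => z + y).continuousAt (by simpa using hU)
    obtain ⟨p, hp, hpU⟩ := exists_continuous_seminorm_ball_subset 𝕜 hU0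
    obtain ⟨m, f, x, hfx⟩ := hfin p hp
    choose L hL using fun i => hfac (f i)
    have hcont : Continuous fun w : ℕ → 𝕜 => ∑ i, ‖L i (w - Φ z)‖ * p (x i) := by fun_prop
    refine ⟨{w | ∑ i, ‖L i (w - Φ z)‖ * p (x i) < 1},
      (isOpen_lt hcont continuous_const).mem_nhds (by simp), fun y hy => ?_⟩
    have h1 : y - z ∈ p.ball 0 1 := by
      rw [Seminorm.mem_ball_zero]
      refine lt_of_le_of_lt ?_ hy
      calc p (y - z) = p ((y - z - ∑ i, f i (y - z) • x i) + ∑ i, f i (y - z) • x i) := by simp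
        _ ≤ p (y - z - ∑ i, f i (y - z) • x i) + p (∑ i, f i (y - z) • x i) := map_add_le_add p _ _
        _ = p (∑ i, f i (y - z) • x i) := by rw [hfx, zero_add]
        _ ≤ ∑ i, p (f i (y - z) • x i) := 
          Finset.le_sum_of_subadditive p (map_zero p).le (map_add_le_add p) _ _
        _ = _ := by simp only [map_smul_eq_mul, hL, map_sub]
    simpa using hpU h1
  have hclosed : IsClosed (Set.range Φ) := by
    refine IsComplete.isClosed (IsUniformInducing.isComplete_range ?_)
    exact AddMonoidHom.isUniformInducing_of_isInducing (f := Φ) hind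
  have hdense : DenseRange Φ := by
    intro a
    choose y hy using fun N : ℕ => exists_forall_apply_eq_of_linearIndependent
      (g := fun i : Fin N => (g i : X →ₗ[𝕜] 𝕜)) ((hli.map' (ContinuousLinearMap.coeLM 𝕜)
        (LinearMap.ker_eq_bot.2 ContinuousLinearMap.coe_injective)).comp _ Fin.val_injective)
      (fun i => a i)
    refine mem_closure_of_tendsto (f := fun N => Φ (y N)) (b := atTop) ?_ (.of_forall fun N => ⟨_, rfl⟩)
    refine tendsto_pi_nhds.2 fun i => tendsto_const_nhds.congr' ?_
    filter_upwards [eventually_gt_atTop i] with N hN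
    exact (hy N ⟨i, hN⟩).symm
  have hsurj : Function.Surjective Φ := by
    rw [← Set.range_eq_univ, ← hclosed.closure_eq, hdense.closure_range]
  exact ⟨{ LinearEquiv.ofBijective (Φ : X →ₗ[𝕜] (ℕ → 𝕜)) ⟨hinj, hsurj⟩ with
    continuous_toFun := Φ.continuous
    continuous_invFun := by
      refine hind.continuous_iff.2 (continuous_id.congr fun w => ?_)
      exact ((LinearEquiv.ofBijective (Φ : X →ₗ[𝕜] (ℕ → 𝕜)) ⟨hinj, hsurj⟩).apply_symm_apply w).symm }⟩

end FiniteRank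

/-! ### The entire function `(exp z - 1) / z` in a Banach algebra. -/

section ExpDiv

variable {𝕜 A : Type*} [RCLike 𝕜] [NormedRing A] [NormedAlgebra 𝕜 A] [CompleteSpace A]

variable (𝕜) in
/-- The entire function `(exp z - 1) / z`, evaluated at an element of a Banach algebra. -/
noncomputable def expSubOneDiv (B : A) : A := ∑' m : ℕ, ((m + 1).factorial : 𝕜)⁻¹ • B ^ m

/-- The factor `max 1 ‖1‖` covers exponent zero, as the unit need not have norm 1. -/
theorem norm_pow_le_max (B : A) {R : ℝ} (hB : ‖B‖ ≤ R) (m : ℕ) :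
    ‖B ^ m‖ ≤ max 1 ‖(1 : A)‖ * R ^ m := by
  have hR : 0 ≤ R := (norm_nonneg B).trans hB
  rcases m.eq_zero_or_pos with rfl | hm
  · simp
  · calc ‖B ^ m‖ ≤ ‖B‖ ^ m := norm_pow_le' B hm
      _ ≤ 1 * R ^ m := by rw [one_mul]; gcongr
      _ ≤ _ := by gcongr; exact le_max_left _ _

theorem norm_expSubOneDiv_term_le (B : A) {R : ℝ} (hB : ‖B‖ ≤ R) (m : ℕ) :
    ‖((m + 1).factorial : 𝕜)⁻¹ • B ^ m‖ ≤ max 1 ‖(1 : A)‖ * (R ^ m / m.factorial) := by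
  have hR : 0 ≤ R := (norm_nonneg B).trans hB
  rw [norm_smul, norm_inv, RCLike.norm_natCast]
  calc ((m + 1).factorial : ℝ)⁻¹ * ‖B ^ m‖
      ≤ (m.factorial : ℝ)⁻¹ * (max 1 ‖(1 : A)‖ * R ^ m) := by
        gcongr
        · exact Nat.le_succ m
        · exact norm_pow_le_max B hB m
    _ = _ := by ring

variable (𝕜) in
theorem summable_expSubOneDiv (B : A) :
    Summable fun m : ℕ => ((m + 1).factorial : 𝕜)⁻¹ • B ^ m :=
  .of_norm_bounded ((Real.summable_pow_div_factorial ‖B‖).mul_left _)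
    (norm_expSubOneDiv_term_le B le_rfl)

variable (𝕜 A) in
theorem continuous_expSubOneDiv : Continuous (expSubOneDiv 𝕜 : A → A) := by
  refine continuous_iff_continuousAt.2 fun B => ?_
  have h : ContinuousOn (expSubOneDiv 𝕜 : A → A) (Metric.closedBall 0 (‖B‖ + 1)) :=
    continuousOn_tsum (fun m => by fun_prop)
      ((Real.summable_pow_div_factorial (‖B‖ + 1)).mul_left (max 1 ‖(1 : A)‖))
      fun m C hC => norm_expSubOneDiv_term_le C (by simpa using hC) m
  exact h.continuousAt (Metric.closedBall_mem_nhds_of_mem (by simp))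

end ExpDiv

/-! ### Operators into and out of `ℓ^∞`. -/

section Frechet

variable {𝕜 X ι : Type*} [RCLike 𝕜] [AddCommGroup X] [Module 𝕜 X] [UniformSpace X]
  [IsUniformAddGroup X] [ContinuousSMul 𝕜 X] [PolynormableSpace 𝕜 X]

variable (𝕜) in
theorem summable_of_seminorm [CompleteSpace X] {u : ι → X}
    (hu : ∀ p : Seminorm 𝕜 X, Continuous p → Summable fun i => p (u i)) : Summable u := by
  refine summable_iff_vanishing.2 fun e he => ?_
  obtain ⟨p, hp, hpe⟩ := exists_continuous_seminorm_ball_subset 𝕜 he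
  obtain ⟨s, hs⟩ := summable_iff_vanishing_norm.1 (hu p hp) 1 one_pos
  refine ⟨s, fun t ht => hpe ?_⟩
  rw [Seminorm.mem_ball_zero]
  calc p (∑ i ∈ t, u i) ≤ ∑ i ∈ t, p (u i) :=
        Finset.le_sum_of_subadditive p (map_zero p).le (map_add_le_add p) _ _
    _ ≤ ‖∑ i ∈ t, p (u i)‖ := le_abs_self _
    _ < 1 := hs t ht

/-- The operator from bounded families of scalars to a complete locally convex space that is given
by an absolutely convergent series. -/
theorem exists_synthesis [CompleteSpace X] [T2Space X] {u : ι → X}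
    (hu : ∀ p : Seminorm 𝕜 X, Continuous p → Summable fun i => p (u i)) :
    ∃ J : lp (fun _ : ι => 𝕜) ⊤ →L[𝕜] X, ∀ a, HasSum (fun i => a i • u i) (J a) := by
  have hle : ∀ (a : lp (fun _ : ι => 𝕜) ⊤) (p : Seminorm 𝕜 X) (i : ι),
      p (a i • u i) ≤ ‖a‖ * p (u i) := fun a p i => by
    rw [map_smul_eq_mul]
    gcongr
    exact lp.norm_apply_le_norm ENNReal.top_ne_zero a i
  have hsum : ∀ a : lp (fun _ : ι => 𝕜) ⊤, Summable fun i => a i • u i := fun a =>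
    summable_of_seminorm 𝕜 fun p hp => Summable.of_nonneg_of_le (fun i => apply_nonneg p _)
      (hle a p) ((hu p hp).mul_left _)
  let J : lp (fun _ : ι => 𝕜) ⊤ →ₗ[𝕜] X :=
    { toFun := fun a => ∑' i, a i • u i
      map_add' := fun a b => by
        rw [← (hsum a).tsum_add (hsum b)]
        simp [add_smul]
      map_smul' := fun c a => by
        rw [RingHom.id_apply, ← (hsum a).tsum_const_smul c]
        simp [mul_smul] }
  refine ⟨⟨J, ?_⟩, fun a => (hsum a).hasSum⟩
  refine continuous_of_continuousAt_zero J ?_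
  rw [ContinuousAt, map_zero]
  refine tendsto_nhds_of_seminorm (𝕜 := 𝕜) fun p hp => ?_
  have hb : ∀ a, p (J a) ≤ ‖a‖ * ∑' i, p (u i) := fun a => by
    refine le_of_tendsto' ((hp.tendsto _).comp (hsum a).hasSum) fun s => ?_
    calc p (∑ i ∈ s, a i • u i) ≤ ∑ i ∈ s, p (a i • u i) :=
          Finset.le_sum_of_subadditive p (map_zero p).le (map_add_le_add p) _ _
      _ ≤ ∑ i ∈ s, ‖a‖ * p (u i) := Finset.sum_le_sum fun i _ => hle a p i
      _ = ‖a‖ * ∑ i ∈ s, p (u i) := by rw [Finset.mul_sum]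
      _ ≤ _ := by
        gcongr
        exact (hu p hp).sum_le_tsum s fun i _ => apply_nonneg p _
  refine squeeze_zero (fun a => apply_nonneg p _) (fun a => by simpa using hb a) ?_
  have : Continuous fun a : lp (fun _ : ι => 𝕜) ⊤ => ‖a‖ * ∑' i, p (u i) := by fun_prop
  simpa using this.tendsto 0

theorem exists_analysis {p : Seminorm 𝕜 X} (hp : Continuous p) {φ : ι → X →L[𝕜] 𝕜}
    (hφ : ∀ i x, ‖φ i x‖ ≤ p x) :
    ∃ F : X →L[𝕜] lp (fun _ : ι => 𝕜) ⊤, (∀ x i, F x i = φ i x) ∧ ∀ x, ‖F x‖ ≤ p x := by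
  have hmem : ∀ x, Memℓp (fun i => φ i x) ⊤ := fun x =>
    memℓp_infty ⟨p x, by rintro _ ⟨i, rfl⟩; exact hφ i x⟩
  let F : X →ₗ[𝕜] lp (fun _ : ι => 𝕜) ⊤ :=
    { toFun := fun x => ⟨fun i => φ i x, hmem x⟩
      map_add' := fun x y => lp.ext (funext fun i => map_add (φ i) x y)
      map_smul' := fun c x => lp.ext (funext fun i => map_smul (φ i) c x) }
  have hF : ∀ x, ‖F x‖ ≤ p x := fun x =>
    lp.norm_le_of_forall_le (apply_nonneg p x) fun i => hφ i x
  refine ⟨⟨F, continuous_of_continuousAt_zero F ?_⟩, fun x i => rfl, hF⟩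
  rw [ContinuousAt, map_zero]
  exact squeeze_zero_norm hF (by simpa using hp.tendsto 0)

end Frechet

/-! ### Taylor's formula for polynomials. -/

section Taylor

open MvPolynomial

variable {σ 𝕜 : Type*} [Field 𝕜] [CharZero 𝕜]

/-- Translation of polynomials by the vector `t`. -/
noncomputable def MvPolynomial.shift (t : σ → 𝕜) : MvPolynomial σ 𝕜 →ₐ[𝕜] MvPolynomial σ 𝕜 :=
  aeval fun i => X i + C (t i)

/-- The directional derivative of polynomials along the vector `t`. -/
noncomputable def MvPolynomial.dirDeriv (t : σ → 𝕜) : Derivation 𝕜 (MvPolynomial σ 𝕜) (MvPolynomial σ 𝕜) :=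
  mkDerivation 𝕜 fun i => C (t i)

theorem MvPolynomial.dirDeriv_apply [Fintype σ] (t : σ → 𝕜) (P : MvPolynomial σ 𝕜) :
    dirDeriv t P = ∑ i, t i • pderiv i P := by
  classical
  induction P using MvPolynomial.induction_on with
  | C a => simp [derivation_C]
  | add P Q hP hQ => simp [hP, hQ, Finset.sum_add_distrib]
  | mul_X Q j hQ =>
    have hX : dirDeriv t (X j) = C (t j) := mkDerivation_X _ _ _
    simp only [Derivation.leibniz, hQ, hX, smul_add, Finset.sum_add_distrib, smul_eq_mul,
      pderiv_X, Finset.mul_sum, mul_smul_comm]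
    congr 1
    simp [Pi.single_apply, smul_eq_C_mul, mul_comm]

/-- Regard `P (x + s t)` as a one-variable polynomial `q P` in `s`. Differentiation in `s`
corresponds to `dirDeriv t`, so its coefficients are the Taylor terms; setting `s = 1` gives the
translate. -/
theorem MvPolynomial.shift_eq_sum (t : σ → 𝕜) (P : MvPolynomial σ 𝕜) :
    ∃ N, (∀ m ≥ N, (dirDeriv t)^[m] P = 0) ∧
      ∀ M ≥ N, shift t P = ∑ m ∈ Finset.range M, (m.factorial : 𝕜)⁻¹ • (dirDeriv t)^[m] P := by
  let q : MvPolynomial σ 𝕜 →ₐ[𝕜] Polynomial (MvPolynomial σ 𝕜) :=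
    aeval fun i => Polynomial.C (X i) + Polynomial.C (C (t i)) * Polynomial.X
  have hC : ∀ a, q (C a) = Polynomial.C (C a) := fun a => by
    rw [← algebraMap_eq, AlgHom.commutes]
    rfl
  have hX : ∀ i, q (X i) = Polynomial.C (X i) + Polynomial.C (C (t i)) * Polynomial.X := fun i => by
    simp [q]
  have hder : ∀ Q, Polynomial.derivative (q Q) = q (dirDeriv t Q) := fun Q => by
    induction Q using MvPolynomial.induction_on with
    | C a => simp [hC, derivation_C]
    | add P Q hP hQ => simp [hP, hQ]
    | mul_X Q i hQ =>
      rw [map_mul, Polynomial.derivative_mul, hQ, Derivation.leibniz, map_add]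
      simp only [smul_eq_mul, map_mul, hX, dirDeriv, mkDerivation_X, hC]
      simp
      ring
  have hiter : ∀ m Q, Polynomial.derivative^[m] (q Q) = q ((dirDeriv t)^[m] Q) := fun m => by
    induction m with
    | zero => simp
    | succ m ih => intro Q; rw [Function.iterate_succ_apply, hder, ih, Function.iterate_succ_apply]
  have h0 : ∀ Q, (q Q).coeff 0 = Q := fun Q => by
    induction Q using MvPolynomial.induction_on with
    | C a => simp [hC]
    | add P Q hP hQ => simp [hP, hQ]
    | mul_X Q i hQ => simp [Polynomial.mul_coeff_zero, hQ, hX]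
  have h1 : ∀ Q, (q Q).eval 1 = shift t Q := fun Q => by
    induction Q using MvPolynomial.induction_on with
    | C a => rw [hC, Polynomial.eval_C, ← algebraMap_eq, AlgHom.commutes]
    | add P Q hP hQ => simp [hP, hQ]
    | mul_X Q i hQ => rw [map_mul, Polynomial.eval_mul, hQ, hX, map_mul]; simp [shift]
  have hcoeff : ∀ m, (q P).coeff m = (m.factorial : 𝕜)⁻¹ • (dirDeriv t)^[m] P := fun m => by
    have := congrArg (Polynomial.coeff · 0) (hiter m P)
    simp only [Polynomial.coeff_iterate_derivative, h0, zero_add, Nat.descFactorial_self] at this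
    rw [← this, ← Nat.cast_smul_eq_nsmul 𝕜, inv_smul_smul₀ (by exact_mod_cast m.factorial_ne_zero)]
  refine ⟨(q P).natDegree + 1, fun m hm => ?_, fun M hM => ?_⟩
  · have h2 := hcoeff m
    rw [Polynomial.coeff_eq_zero_of_natDegree_lt (by omega)] at h2
    exact (smul_eq_zero.1 h2.symm).resolve_left (by simp [m.factorial_ne_zero])
  · rw [← h1, Polynomial.eval_eq_sum_range' (n := M) (by omega)]
    simp [hcoeff]

end Taylor

/-! ### Families of polynomials with decaying or growing coefficients. -/

section PolynomialAsymptotics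

open MvPolynomial Asymptotics

variable {σ 𝕜 T : Type*} [RCLike 𝕜] {l : Filter T} {g h : T → ℝ}
  {p q : T → MvPolynomial σ 𝕜}

/-- A family of polynomials of bounded degree whose coefficients are `O(g)`. -/
def CoeffIsBigO (l : Filter T) (g : T → ℝ) (p : T → MvPolynomial σ 𝕜) : Prop :=
  (∃ D, ∀ᶠ t in l, (p t).totalDegree ≤ D) ∧ ∀ ν, (fun t => coeff ν (p t)) =O[l] g

theorem CoeffIsBigO.congr (hp : CoeffIsBigO l g p) (hpq : ∀ᶠ t in l, p t = q t) :
    CoeffIsBigO l g q := by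
  obtain ⟨⟨D, hD⟩, hc⟩ := hp
  refine ⟨⟨D, ?_⟩, fun ν => (hc ν).congr' ?_ .rfl⟩
  · filter_upwards [hD, hpq] with t h1 h2
    rwa [← h2]
  · filter_upwards [hpq] with t h2
    rw [h2]

theorem CoeffIsBigO.mono (hp : CoeffIsBigO l g p) (hgh : g =O[l] h) : CoeffIsBigO l h p :=
  ⟨hp.1, fun ν => (hp.2 ν).trans hgh⟩

theorem CoeffIsBigO.add (hp : CoeffIsBigO l g p) (hq : CoeffIsBigO l g q) :
    CoeffIsBigO l g fun t => p t + q t := by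
  obtain ⟨⟨D, hD⟩, hc⟩ := hp
  obtain ⟨⟨D', hD'⟩, hc'⟩ := hq
  refine ⟨⟨max D D', ?_⟩, fun ν => by simpa using (hc ν).add (hc' ν)⟩
  filter_upwards [hD, hD'] with t h1 h2
  exact (totalDegree_add _ _).trans (max_le_max h1 h2)

theorem CoeffIsBigO.mul (hp : CoeffIsBigO l g p) (hq : CoeffIsBigO l h q) :
    CoeffIsBigO l (fun t => g t * h t) fun t => p t * q t := by
  classical
  obtain ⟨⟨D, hD⟩, hc⟩ := hp
  obtain ⟨⟨D', hD'⟩, hc'⟩ := hq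
  refine ⟨⟨D + D', ?_⟩, fun ν => ?_⟩
  · filter_upwards [hD, hD'] with t h1 h2
    exact (totalDegree_mul _ _).trans (add_le_add h1 h2)
  · simp_rw [coeff_mul]
    exact IsBigO.fun_sum fun i _ => (hc _).mul (hc' _)

theorem CoeffIsBigO.const (P : MvPolynomial σ 𝕜) : CoeffIsBigO l (fun _ => 1) fun _ => P :=
  ⟨⟨P.totalDegree, .of_forall fun _ => le_rfl⟩, fun _ => isBigO_const_const _ one_ne_zero _⟩

theorem CoeffIsBigO.smul {c : T → 𝕜} (hc : c =O[l] g) (P : MvPolynomial σ 𝕜) :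
    CoeffIsBigO l g fun t => c t • P := by
  refine ⟨⟨P.totalDegree, .of_forall fun _ => totalDegree_smul_le _ _⟩, fun ν => ?_⟩
  simpa only [coeff_smul, smul_eq_mul, mul_comm] using hc.const_mul_left (coeff ν P)

theorem CoeffIsBigO.sum {ι : Type*} (s : Finset ι) {p : ι → T → MvPolynomial σ 𝕜}
    (hp : ∀ i ∈ s, CoeffIsBigO l g (p i)) : CoeffIsBigO l g fun t => ∑ i ∈ s, p i t := by
  classical
  induction s using Finset.induction_on with
  | empty => exact ⟨⟨0, by simp⟩, fun ν => by simpa using isBigO_zero g l⟩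
  | insert a s ha ih =>
    simp_rw [Finset.sum_insert ha]
    exact (hp a (by simp)).add (ih fun i hi => hp i (by simp [hi]))

theorem CoeffIsBigO.pow (hp : CoeffIsBigO l g p) (n : ℕ) :
    CoeffIsBigO l (fun t => g t ^ n) fun t => p t ^ n := by
  induction n with
  | zero => simpa using CoeffIsBigO.const (l := l) (1 : MvPolynomial σ 𝕜)
  | succ n ih => simpa only [pow_succ] using ih.mul hp

theorem CoeffIsBigO.neg (hp : CoeffIsBigO l g p) : CoeffIsBigO l g fun t => - p t := by
  simpa using (CoeffIsBigO.const (-1 : MvPolynomial σ 𝕜)).mul hp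

theorem CoeffIsBigO.sub (hp : CoeffIsBigO l g p) (hq : CoeffIsBigO l g q) :
    CoeffIsBigO l g fun t => p t - q t := by
  simpa only [sub_eq_add_neg] using hp.add hq.neg

theorem CoeffIsBigO.aeval (hp : CoeffIsBigO l (fun _ => 1) p) (a : Polynomial 𝕜) :
    CoeffIsBigO l (fun _ => 1) fun t => Polynomial.aeval (p t) a := by
  simp_rw [Polynomial.aeval_eq_sum_range]
  refine CoeffIsBigO.sum _ fun n _ => ?_
  have := (CoeffIsBigO.const (l := l) (C (a.coeff n) : MvPolynomial σ 𝕜)).mul (hp.pow n)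
  simpa [smul_eq_C_mul] using this

/-- Each variable of a monomial costs one factor `g`, and `1 ≤ g` allows raising exponents to a
common one. -/
theorem CoeffIsBigO.exists_shift {c : T → σ → 𝕜} (hg : ∀ᶠ t in l, 1 ≤ g t)
    (hc : ∀ i, (fun t => c t i) =O[l] g) (P : MvPolynomial σ 𝕜) :
    ∃ N : ℕ, ∀ M ≥ N, CoeffIsBigO l (fun t => g t ^ M) fun t => shift (c t) P := by
  have hmono : ∀ {m n : ℕ}, m ≤ n → (fun t => g t ^ m) =O[l] fun t => g t ^ n := fun hmn => by
    refine IsBigO.of_bound 1 ?_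
    filter_upwards [hg] with t ht
    have h0 : 0 ≤ g t := zero_le_one.trans ht
    rw [one_mul, Real.norm_of_nonneg (pow_nonneg h0 _), Real.norm_of_nonneg (pow_nonneg h0 _)]
    exact pow_le_pow_right₀ ht hmn
  suffices ∃ N : ℕ, CoeffIsBigO l (fun t => g t ^ N) fun t => shift (c t) P by
    obtain ⟨N, hN⟩ := this
    exact ⟨N, fun M hM => hN.mono (hmono hM)⟩
  induction P using MvPolynomial.induction_on with
  | C a => exact ⟨0, by simpa [shift] using CoeffIsBigO.const (C a)⟩
  | add P Q hP hQ =>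
    obtain ⟨N, hN⟩ := hP
    obtain ⟨N', hN'⟩ := hQ
    refine ⟨max N N', ?_⟩
    simp only [map_add]
    exact (hN.mono (hmono (le_max_left _ _))).add (hN'.mono (hmono (le_max_right _ _)))
  | mul_X P i hP =>
    obtain ⟨N, hN⟩ := hP
    refine ⟨N + 1, ?_⟩
    have h1 : CoeffIsBigO l (fun t => g t ^ 1) fun t => X i + c t i • (1 : MvPolynomial σ 𝕜) :=
      ((CoeffIsBigO.const (X i)).mono (by simpa using hmono zero_le_one)).add
        (.smul (by simpa using hc i) 1)
    refine (hN.mul h1).congr (.of_forall fun t => ?_) |>.mono (by simpa [pow_succ] using isBigO_refl _ _)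
    simp [shift, smul_eq_C_mul]

/-- Bounded degree in finitely many variables confines everything to a fixed finite set of
monomials, so coefficientwise decay suffices and `Ψ` needs no continuity. -/
theorem CoeffIsBigO.tendsto [Finite σ] {X : Type*} [AddCommGroup X] [Module 𝕜 X]
    [TopologicalSpace X] [IsTopologicalAddGroup X] [ContinuousSMul 𝕜 X]
    (hp : CoeffIsBigO l g p) (hg : Tendsto g l (𝓝 0)) (Ψ : MvPolynomial σ 𝕜 →ₗ[𝕜] X) :
    Tendsto (fun t => Ψ (p t)) l (𝓝 0) := by
  classical
  obtain ⟨⟨D, hD⟩, hc⟩ := hp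
  have hfin : {ν : σ →₀ ℕ | ν.degree ≤ D}.Finite := Finsupp.finite_of_degree_le D
  have hsum : ∀ᶠ t in l, ∑ ν ∈ hfin.toFinset, coeff ν (p t) • Ψ (monomial ν 1) = Ψ (p t) := by
    filter_upwards [hD] with t ht
    conv_rhs => rw [(p t).as_sum, map_sum]
    rw [← Finset.sum_subset (s₁ := (p t).support)]
    · refine Finset.sum_congr rfl fun ν _ => ?_
      rw [← map_smul, smul_monomial, smul_eq_mul, mul_one]
    · intro ν hν
      rw [Set.Finite.mem_toFinset]
      exact (le_totalDegree hν).trans ht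
    · intro ν _ hν
      rw [notMem_support_iff.1 hν, zero_smul]
  refine Tendsto.congr' hsum ?_
  have h1 : ∀ ν, Tendsto (fun t => coeff ν (p t) • Ψ (monomial ν 1)) l (𝓝 0) := fun ν => by
    simpa using ((hc ν).trans_tendsto hg).smul_const (Ψ (monomial ν 1))
  simpa using tendsto_finsetSum hfin.toFinset fun ν _ => h1 ν

end PolynomialAsymptotics

/-! ### Polynomials close to `u` whose translates are close to `v`. -/

section Interpolation

open MvPolynomial Asymptotics Bornology

variable {𝕜 : Type*} [RCLike 𝕜] {k : ℕ}

theorem MvPolynomial.shift_shift_neg {σ : Type*} (t : σ → 𝕜) (P : MvPolynomial σ 𝕜) :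
    shift t (shift (-t) P) = P := by
  have : (shift t).comp (shift (-t)) = AlgHom.id 𝕜 (MvPolynomial σ 𝕜) := by
    ext i
    simp [shift]
  exact DFunLike.congr_fun this P

/-- Glue `u` and the back-translate of `v` by a cutoff `η` that is nearly 1 before translation and
nearly 0 after it. Translates grow at most like `‖t‖ ^ N`, while the cutoff errors are `O(‖t‖ ^ (-(N
+ 1)))`. -/
theorem exists_interpolating_polynomials (u v : MvPolynomial (Fin k) 𝕜) :
    ∃ w : EuclideanSpace ℝ (Fin k) → MvPolynomial (Fin k) 𝕜,
      CoeffIsBigO (cobounded _) (fun t => ‖t‖⁻¹) (fun t => w t - u) ∧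
      CoeffIsBigO (cobounded _) (fun t => ‖t‖⁻¹)
        (fun t => shift (fun i => (t i : 𝕜)) (w t) - v) := by
  set L := cobounded (EuclideanSpace ℝ (Fin k))
  have hg : ∀ᶠ t in L, 1 ≤ ‖t‖ := tendsto_norm_cobounded_atTop.eventually_ge_atTop 1
  have hcoord : ∀ (t : EuclideanSpace ℝ (Fin k)) i, ‖(t i : 𝕜)‖ ≤ ‖t‖ := fun t i => by
    simpa using PiLp.norm_apply_le t i
  have hc : ∀ i, (fun t : EuclideanSpace ℝ (Fin k) => (t i : 𝕜)) =O[L] fun t => ‖t‖ := fun i =>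
    IsBigO.of_bound 1 (.of_forall fun t => by simpa using hcoord t i)
  obtain ⟨N₁, h₁⟩ := CoeffIsBigO.exists_shift hg (c := fun t => -fun i => (t i : 𝕜))
    (fun i => by simpa using (hc i).neg_left) v
  obtain ⟨N₂, h₂⟩ := CoeffIsBigO.exists_shift hg (c := fun t i => (t i : 𝕜)) hc u
  set N := max N₁ N₂
  replace h₁ := h₁ N (le_max_left _ _)
  replace h₂ := h₂ N (le_max_right _ _)
  have h1N : (fun _ : EuclideanSpace ℝ (Fin k) => (1 : ℝ)) =O[L] fun t => ‖t‖ ^ N := by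
    refine IsBigO.of_bound 1 ?_
    filter_upwards [hg] with t ht
    simpa using one_le_pow₀ ht
  -- The linear form `⟨x, t⟩ / ‖t‖²` is of size `1 / ‖t‖`, and translation by `t` adds exactly 1 to
  -- it.
  let ℓ : EuclideanSpace ℝ (Fin k) → MvPolynomial (Fin k) 𝕜 :=
    fun t => ∑ i, ((t i : 𝕜) / ((‖t‖ : ℝ) : 𝕜) ^ 2) • X i
  have hℓ : CoeffIsBigO L (fun t => ‖t‖⁻¹) ℓ := by
    refine CoeffIsBigO.sum _ fun i _ => .smul (IsBigO.of_bound 1 ?_) _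
    filter_upwards [hg] with t ht
    have ht0 : 0 < ‖t‖ := one_pos.trans_le ht
    rw [norm_div, norm_pow, RCLike.norm_ofReal (K := 𝕜) ‖t‖, abs_of_pos ht0, one_mul, norm_inv,
      norm_norm, div_le_iff₀ (by positivity)]
    calc ‖(t i : 𝕜)‖ ≤ ‖t‖ := hcoord t i
      _ = ‖t‖⁻¹ * ‖t‖ ^ 2 := by field_simp
  have hinv : (fun t : EuclideanSpace ℝ (Fin k) => ‖t‖⁻¹) =O[L] fun _ => (1 : ℝ) := by
    refine IsBigO.of_bound 1 ?_
    filter_upwards [hg] with t ht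
    simpa using inv_le_one_of_one_le₀ ht
  have hℓ1 : CoeffIsBigO L (fun _ => 1) ℓ := hℓ.mono hinv
  have hprod : (fun t : EuclideanSpace ℝ (Fin k) => ‖t‖ ^ N * (1 * ‖t‖⁻¹ ^ (N + 1))) =O[L]
      fun t => ‖t‖⁻¹ := by
    refine IsBigO.of_bound 1 ?_
    filter_upwards [hg] with t ht
    have ht0 : ‖t‖ ≠ 0 := (one_pos.trans_le ht).ne'
    rw [pow_succ, one_mul, ← mul_assoc, inv_pow, mul_inv_cancel₀ (pow_ne_zero _ ht0)]
    simp
  have hshiftℓ : ∀ᶠ t in L, shift (fun i => (t i : 𝕜)) (ℓ t) = ℓ t + 1 := by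
    filter_upwards [hg] with t ht
    have ht0 : ‖t‖ ≠ 0 := (one_pos.trans_le ht).ne'
    have hs : ∑ i, (t i : 𝕜) / ((‖t‖ : ℝ) : 𝕜) ^ 2 * (t i : 𝕜) = 1 := by
      have h3 : ((‖t‖ : ℝ) : 𝕜) ^ 2 = ∑ i, (t i : 𝕜) * (t i : 𝕜) := by
        rw [← RCLike.ofReal_pow, EuclideanSpace.norm_sq_eq]
        simp [sq]
      have h4 : ((‖t‖ : ℝ) : 𝕜) ^ 2 ≠ 0 := by simpa using ht0
      simp_rw [div_mul_eq_mul_div]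
      rw [← Finset.sum_div, ← h3, div_self h4]
    calc shift (fun i => (t i : 𝕜)) (ℓ t)
        = ℓ t + C (∑ i, (t i : 𝕜) / ((‖t‖ : ℝ) : 𝕜) ^ 2 * (t i : 𝕜)) := by
          simp only [ℓ, map_sum, map_smul, shift, aeval_X, smul_add, Finset.sum_add_distrib]
          simp only [smul_eq_C_mul, C_mul]
      _ = ℓ t + 1 := by rw [hs, C_1]
  -- Bézout gives a polynomial congruent to 1 modulo `X ^ (N + 1)` and to 0 modulo `(1 - X) ^ (N +
  -- 1)`; the cutoff is its value at `ℓ t`.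
  obtain ⟨a, b, hab⟩ : IsCoprime ((Polynomial.X : Polynomial 𝕜) ^ (N + 1))
      ((1 - Polynomial.X) ^ (N + 1)) := IsCoprime.pow ⟨1, 1, by ring⟩
  have hab' : ∀ x : MvPolynomial (Fin k) 𝕜, Polynomial.aeval x a * x ^ (N + 1) +
      Polynomial.aeval x b * (1 - x) ^ (N + 1) = 1 := fun x => by
    simpa using congrArg (Polynomial.aeval x) hab
  let η : EuclideanSpace ℝ (Fin k) → MvPolynomial (Fin k) 𝕜 := fun t =>
    Polynomial.aeval (ℓ t) b * (1 - ℓ t) ^ (N + 1)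
  refine ⟨fun t => u * η t + shift (-fun i => (t i : 𝕜)) v * (1 - η t), ?_, ?_⟩
  · refine (((h₁.sub ((CoeffIsBigO.const u).mono h1N)).mul
      ((hℓ1.aeval a).mul (hℓ.pow (N + 1)))).mono hprod).congr (.of_forall fun t => ?_)
    rw [eq_sub_of_add_eq (hab' (ℓ t))]
    ring
  · have h5 : CoeffIsBigO L (fun _ => 1) fun t => ℓ t + 1 := hℓ1.add (.const 1)
    -- After translation `1 - ℓ` becomes `-ℓ`, so the translated cutoff is the small factor here, in
    -- place of `1 - η`.
    refine (((h₂.sub ((CoeffIsBigO.const v).mono h1N)).mul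
      ((h5.aeval b).mul (hℓ.neg.pow (N + 1)))).mono hprod).congr ?_
    filter_upwards [hshiftℓ] with t ht
    have hη : shift (fun i => (t i : 𝕜)) (η t) =
        Polynomial.aeval (ℓ t + 1) b * (-ℓ t) ^ (N + 1) := by
      simp only [η, map_mul, map_pow, map_sub, map_one, ← Polynomial.aeval_algHom_apply, ht]
      ring
    simp only [map_add, map_mul, map_sub, map_one, shift_shift_neg, hη]
    ring

end Interpolation

/-! ### The exponential group and its translation model. -/

section ExponentialGroup

open MvPolynomial

variable {𝕜 X E : Type*} [RCLike 𝕜] [AddCommGroup X] [Module 𝕜 X] [UniformSpace X]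
  [IsUniformAddGroup X] [ContinuousSMul 𝕜 X] [PolynormableSpace 𝕜 X]
  [NormedAddCommGroup E] [NormedSpace 𝕜 E] [CompleteSpace E] {k : ℕ}

/-- The combination `∑ j, t j • F j` of operators `F j`. -/
noncomputable def combination (F : Fin k → X →L[𝕜] E) (t : EuclideanSpace ℝ (Fin k)) : X →L[𝕜] E :=
  ∑ j, (t j : 𝕜) • F j

/-- The exponential of `∑ j, t j • J ∘ F j`, where the operators `F j` and `J` are factors through a
Banach space. -/
noncomputable def expGroup (J : E →L[𝕜] X) (F : Fin k → X →L[𝕜] E)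
    (t : EuclideanSpace ℝ (Fin k)) : X →L[𝕜] X :=
  ContinuousLinearMap.id 𝕜 X +
    J.comp ((expSubOneDiv 𝕜 ((combination F t).comp J)).comp (combination F t))

theorem continuous_combination_comp (J : E →L[𝕜] X) (F : Fin k → X →L[𝕜] E) :
    Continuous fun t => (combination F t).comp J := by
  have : ∀ t, (combination F t).comp J = ∑ j, (t j : 𝕜) • (F j).comp J := fun t => by
    ext x
    simp [combination]
  simp_rw [this]
  fun_prop

/-- The difference of two group elements is `J` applied to `∑ j, (s j G(s) - t j G(t)) (F j x)`. On
the unit ball of `p` all `‖F j x‖ ≤ 1`, so norm continuity of `G` suffices and one ball serves every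
`t`. -/
theorem isUniformlyContinuousFamily_expGroup (J : E →L[𝕜] X) (F : Fin k → X →L[𝕜] E)
    {p : Seminorm 𝕜 X} (hp : Continuous p) (hF : ∀ j x, ‖F j x‖ ≤ p x) :
    IsUniformlyContinuousFamily (expGroup J F) := by
  refine ⟨p.ball 0 1, p.ball_mem_nhds hp one_pos, fun u t hut => ?_⟩
  let G : EuclideanSpace ℝ (Fin k) → E →L[𝕜] E := fun s =>
    expSubOneDiv 𝕜 ((combination F s).comp J)
  have hG : Continuous G :=
    (continuous_expSubOneDiv 𝕜 (E →L[𝕜] E)).comp (continuous_combination_comp J F)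
  have hcont : Continuous fun s : EuclideanSpace ℝ (Fin k) =>
      ∑ j, ‖(s j : 𝕜) • G s - (t j : 𝕜) • G t‖ := by fun_prop
  have hlim := (hcont.tendsto t).comp hut
  simp only [sub_self, norm_zero, Finset.sum_const_zero] at hlim
  rw [IsTopologicalAddGroup.tendstoUniformlyOn_iff _ _ _ _ IsUniformAddGroup.rightUniformSpace_eq]
  intro W hW
  have hJW : J ⁻¹' W ∈ 𝓝 (0 : E) := J.continuous.continuousAt (by simpa using hW)
  obtain ⟨ε, hε, hεW⟩ := Metric.mem_nhds_iff.1 hJW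
  filter_upwards [hlim.eventually (gt_mem_nhds hε)] with n hn x hx
  have hx1 : p x ≤ 1 := ((p.mem_ball_zero).1 hx).le
  have he : expGroup J F (u n) x - expGroup J F t x =
      J (∑ j, ((u n j : 𝕜) • G (u n) - (t j : 𝕜) • G t) (F j x)) := by
    simp only [expGroup, add_apply, ContinuousLinearMap.comp_apply, add_sub_add_left_eq_sub,
      ← map_sub]
    simp [combination, G, map_sum, sum_apply, Finset.sum_sub_distrib]
  rw [he]
  refine hεW (mem_ball_zero_iff.2 (lt_of_le_of_lt ?_ hn))
  refine (norm_sum_le _ _).trans (Finset.sum_le_sum fun j _ => ?_)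
  exact (ContinuousLinearMap.le_opNorm _ _).trans
    (mul_le_of_le_one_right (norm_nonneg _) ((hF j x).trans hx1))

variable {J : E →L[𝕜] X} {F : Fin k → X →L[𝕜] E} {Ψ : MvPolynomial (Fin k) 𝕜 →ₗ[𝕜] X}

/-- On the image of `Ψ` the exponent acts as `dirDeriv t`, so the exponential series terminates and
is Taylor's formula. -/
theorem expGroup_apply_polynomial (hΨ : ∀ j P, J (F j (Ψ P)) = Ψ (pderiv j P))
    (t : EuclideanSpace ℝ (Fin k)) (P : MvPolynomial (Fin k) 𝕜) :
    expGroup J F t (Ψ P) = Ψ (shift (fun j => (t j : 𝕜)) P) := by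
  set D := dirDeriv fun j => (t j : 𝕜) with hDdef
  have hD : ∀ Q, J (combination F t (Ψ Q)) = Ψ (D Q) := fun Q => by
    simp only [D, dirDeriv_apply, combination, sum_apply, smul_apply, map_sum, map_smul, hΨ]
  have hpow : ∀ m Q, (((combination F t).comp J) ^ m) (combination F t (Ψ Q)) =
      combination F t (Ψ (D^[m] Q)) := fun m => by
    induction m with
    | zero => simp
    | succ m ih =>
      intro Q
      rw [pow_succ, mul_apply_eq_comp, ContinuousLinearMap.comp_apply, hD, ih,
        Function.iterate_succ_apply]
  obtain ⟨N, hN, hsum⟩ := shift_eq_sum (fun j => (t j : 𝕜)) P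
  have happ : expSubOneDiv 𝕜 ((combination F t).comp J) (combination F t (Ψ P)) =
      ∑ m ∈ Finset.range N, ((m + 1).factorial : 𝕜)⁻¹ • combination F t (Ψ (D^[m] P)) := by
    have h1 := ((summable_expSubOneDiv 𝕜 ((combination F t).comp J)).hasSum.mapL
      (ContinuousLinearMap.apply 𝕜 E (combination F t (Ψ P))))
    refine h1.unique ?_
    simp only [ContinuousLinearMap.apply_apply, smul_apply, hpow]
    refine hasSum_sum_of_ne_finset_zero fun m hm => ?_
    rw [show D^[m] P = 0 from hN m (by simpa using hm)]
    simp
  -- One extra term is taken because the zeroth is the identity summand and the other `N` come from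
  -- `expSubOneDiv`.
  rw [hsum (N + 1) (by omega), ← hDdef, Finset.sum_range_succ']
  simp only [expGroup, add_apply, ContinuousLinearMap.comp_apply, happ, map_sum,
    map_smul, hD, ContinuousLinearMap.id_apply]
  simp only [← Function.iterate_succ_apply' D]
  simp [add_comm]

theorem isOperatorSemigroup_expGroup [T2Space X] (hΨ : ∀ j P, J (F j (Ψ P)) = Ψ (pderiv j P))
    (hd : DenseRange Ψ) : IsOperatorSemigroup (expGroup J F) := by
  have hext : ∀ A B : X →L[𝕜] X, (∀ P, A (Ψ P) = B (Ψ P)) → A = B := fun A B h =>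
    ContinuousLinearMap.coeFn_injective (hd.equalizer A.continuous B.continuous (funext h))
  refine ⟨hext _ _ fun P => ?_, fun s t => hext _ _ fun P => ?_⟩
  · rw [expGroup_apply_polynomial hΨ]
    simp [shift]
  · rw [ContinuousLinearMap.comp_apply]
    simp only [expGroup_apply_polynomial hΨ]
    congr 1
    rw [← AlgHom.comp_apply]
    refine DFunLike.congr_fun (MvPolynomial.algHom_ext fun i => ?_) P
    simp only [shift, AlgHom.comp_apply, aeval_X, map_add, PiLp.add_apply, MvPolynomial.algHom_C,
      algebraMap_eq]
    abel

theorem isMixingFamily_expGroup (hΨ : ∀ j P, J (F j (Ψ P)) = Ψ (pderiv j P))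
    (hd : DenseRange Ψ) : IsMixingFamily (expGroup J F) := by
  intro U V hU hUne hV hVne
  obtain ⟨u, hu⟩ := hd.exists_mem_open hU hUne
  obtain ⟨v, hv⟩ := hd.exists_mem_open hV hVne
  obtain ⟨w, hw, hw'⟩ := exists_interpolating_polynomials u v
  have hlim := tendsto_norm_cobounded_atTop (E := EuclideanSpace ℝ (Fin k)).inv_tendsto_atTop
  have h1 : Tendsto (fun t => Ψ (w t)) (Bornology.cobounded _) (𝓝 (Ψ u)) := by
    simpa using (hw.tendsto hlim Ψ).add_const (Ψ u)
  have h2 : Tendsto (fun t => Ψ (shift (fun i => (t i : 𝕜)) (w t))) (Bornology.cobounded _)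
      (𝓝 (Ψ v)) := by
    simpa using (hw'.tendsto hlim Ψ).add_const (Ψ v)
  have h3 := (h1.eventually_mem (hU.mem_nhds hu)).and (h2.eventually_mem (hV.mem_nhds hv))
  obtain ⟨r, -, hr⟩ := (Filter.hasBasis_cobounded_norm (E := EuclideanSpace ℝ (Fin k))).eventually_iff.1 h3
  refine ⟨max r 1, by positivity, fun t ht => ?_⟩
  obtain ⟨h4, h5⟩ := hr (show r ≤ ‖t‖ from (le_max_left _ _).trans ht.le)
  exact ⟨_, ⟨_, h4, rfl⟩, by rwa [expGroup_apply_polynomial hΨ]⟩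

end ExponentialGroup

/-! ### Weights depending only on the degree. -/

section Weights

theorem exists_pos_mul_le_of_finite_fibers {ι : Type*} {d : ι → ℕ}
    (hd : ∀ n, {i | d i = n}.Finite) {M ε : ι → ℝ} (hM : ∀ i, 0 ≤ M i) (hε : ∀ i, 0 < ε i) :
    ∃ δ : ℕ → ℝ, (∀ n, 0 < δ n) ∧ ∀ i, δ (d i) * M i ≤ ε i := by
  have hS : ∀ n, 0 ≤ ∑ i ∈ (hd n).toFinset, M i / ε i := fun n =>
    Finset.sum_nonneg fun i _ => div_nonneg (hM i) (hε i).le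
  refine ⟨fun n => (1 + ∑ i ∈ (hd n).toFinset, M i / ε i)⁻¹,
    fun n => inv_pos.2 (by linarith [hS n]), fun i => ?_⟩
  have h1 : M i / ε i ≤ ∑ i ∈ (hd (d i)).toFinset, M i / ε i :=
    Finset.single_le_sum (f := fun i => M i / ε i) (fun j _ => div_nonneg (hM j) (hε j).le)
      (by simp)
  rw [inv_mul_le_iff₀ (by linarith [hS (d i)])]
  calc M i = M i / ε i * ε i := (div_mul_cancel₀ _ (hε i).ne').symm
    _ ≤ _ := by
      gcongr
      · exact (hε i).le
      · linarith

end Weights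

/-! ### Realizing partial derivatives through `ℓ^∞`. -/

section Intertwining

open MvPolynomial

variable {𝕜 X : Type*} [RCLike 𝕜] [AddCommGroup X] [Module 𝕜 X] [UniformSpace X]
  [IsUniformAddGroup X] [ContinuousSMul 𝕜 X] [PolynormableSpace 𝕜 X]

theorem exists_factors_of_biorthogonal [FirstCountableTopology X] [CompleteSpace X] [T2Space X]
    {k : ℕ} {p : Seminorm 𝕜 X} (hp : Continuous p)
    {x : (Fin k →₀ ℕ) → X} {f : (Fin k →₀ ℕ) → X →L[𝕜] 𝕜}
    (hxf : ∀ μ ν, f μ (x ν) = if μ = ν then 1 else 0)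
    (hf : ∀ ν, ∃ C, 0 ≤ C ∧ ∀ y, ‖f ν y‖ ≤ C * p y)
    (hd : Dense (Submodule.span 𝕜 (Set.range x) : Set X)) :
    ∃ (J : lp (fun _ : Fin k →₀ ℕ => 𝕜) ⊤ →L[𝕜] X)
      (F : Fin k → X →L[𝕜] lp (fun _ : Fin k →₀ ℕ => 𝕜) ⊤) (Ψ : MvPolynomial (Fin k) 𝕜 →ₗ[𝕜] X),
      (∀ j y, ‖F j y‖ ≤ p y) ∧ (∀ j P, J (F j (Ψ P)) = Ψ (pderiv j P)) ∧ DenseRange Ψ := by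
  classical
  obtain ⟨q, hq, hqd⟩ := exists_seq_continuous_seminorm 𝕜 X
  choose C hC0 hC using hf
  -- `B ν` dominates the norms of all the functionals used at `ν`: `F j` divides by it, and `J`
  -- multiplies it back.
  let B : (Fin k →₀ ℕ) → ℝ := fun ν => 1 + ∑ j, (ν j + 1) * C (ν + Finsupp.single j 1)
  have hBj : ∀ ν j, (ν j + 1) * C (ν + Finsupp.single j 1) ≤ B ν := fun ν j => by
    have := Finset.single_le_sum (f := fun j => ((ν j : ℝ) + 1) * C (ν + Finsupp.single j 1))
      (fun i _ => mul_nonneg (by positivity) (hC0 _)) (Finset.mem_univ j)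
    simp only [B]
    linarith
  have hB : ∀ ν, 0 < B ν := fun ν =>
    add_pos_of_pos_of_nonneg one_pos
      (Finset.sum_nonneg fun i _ => mul_nonneg (by positivity) (hC0 _))
  have hfin : ∀ n, {ν : Fin k →₀ ℕ | ν.degree ≤ n}.Finite := Finsupp.finite_of_degree_le
  let _ : Encodable (Fin k →₀ ℕ) := Encodable.ofCountable _
  -- The weight at `ν` tames the seminorms `q 0, …, q |ν|`, so each `q m` is handled at all but
  -- finitely many `ν`. It depends on the degree alone so that the same rescaling of `x ν` serves
  -- every direction `j`.
  obtain ⟨ε, hε, c, hεc, -⟩ := posSumOfEncodable one_pos (Fin k →₀ ℕ)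
  obtain ⟨δ, hδ, hδM⟩ := exists_pos_mul_le_of_finite_fibers
    (d := fun ν : Fin k →₀ ℕ => ν.degree) (fun n => (hfin n).subset fun ν hν => le_of_eq hν)
    (M := fun ν => B ν * ∑ m ∈ Finset.range (ν.degree + 1), q m (x ν))
    (fun ν => mul_nonneg (hB ν).le (Finset.sum_nonneg fun m _ => apply_nonneg _ _)) hε
  have hu : ∀ r : Seminorm 𝕜 X, Continuous r →
      Summable fun ν => r (((B ν * δ ν.degree : ℝ) : 𝕜) • x ν) := by
    intro r hr
    obtain ⟨m, hm⟩ := hqd r hr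
    refine Summable.of_norm_bounded_eventually hεc.summable ?_
    refine (hfin m).subset fun ν hν => ?_
    by_contra hνm
    refine hν ?_
    have hνm' : m ≤ ν.degree := (not_le.1 hνm).le
    change ‖r _‖ ≤ ε ν
    rw [Real.norm_of_nonneg (apply_nonneg r _), map_smul_eq_mul, RCLike.norm_ofReal,
      abs_of_pos (mul_pos (hB ν) (hδ _))]
    refine le_trans ?_ (hδM ν)
    rw [mul_comm (B ν), mul_assoc]
    refine mul_le_mul_of_nonneg_left (mul_le_mul_of_nonneg_left ?_ (hB ν).le) (hδ _).le
    exact (hm _).trans (Finset.single_le_sum (f := fun m => q m (x ν))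
      (fun i _ => apply_nonneg _ _) (by simp; omega))
  obtain ⟨J, hJ⟩ := exists_synthesis hu
  have hF : ∀ j, ∃ F : X →L[𝕜] lp (fun _ : Fin k →₀ ℕ => 𝕜) ⊤,
      (∀ y ν, F y ν = (((ν j + 1 : ℝ) / B ν : ℝ) : 𝕜) * f (ν + Finsupp.single j 1) y) ∧
      ∀ y, ‖F y‖ ≤ p y := fun j => by
    refine exists_analysis hp
      (φ := fun ν => (((ν j + 1 : ℝ) / B ν : ℝ) : 𝕜) • f (ν + Finsupp.single j 1)) fun ν y => ?_
    rw [smul_apply, norm_smul, RCLike.norm_ofReal,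
      abs_of_nonneg (div_nonneg (by positivity) (hB ν).le), div_mul_eq_mul_div, div_le_iff₀ (hB ν)]
    calc (ν j + 1 : ℝ) * ‖f (ν + Finsupp.single j 1) y‖
        ≤ (ν j + 1) * (C (ν + Finsupp.single j 1) * p y) := by gcongr; exact hC _ _
      _ = ((ν j + 1) * C (ν + Finsupp.single j 1)) * p y := by ring
      _ ≤ B ν * p y := by gcongr; exact hBj ν j
      _ = _ := mul_comm _ _
  choose F hFe hFp using hF
  -- The relation `s (n + 1) * δ n = s n` absorbs the weight, leaving the exact coefficient of
  -- `pderiv`.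
  let s : ℕ → ℝ := fun n => ∏ i ∈ Finset.range n, (δ i)⁻¹
  have hs : ∀ n, s n ≠ 0 := fun n => Finset.prod_ne_zero_iff.2 fun i _ => inv_ne_zero (hδ i).ne'
  have hss : ∀ n, s (n + 1) * δ n = s n := fun n => by
    simp only [s, Finset.prod_range_succ]
    rw [mul_assoc, inv_mul_cancel₀ (hδ n).ne', mul_one]
  let Ψ : MvPolynomial (Fin k) 𝕜 →ₗ[𝕜] X :=
    (basisMonomials (Fin k) 𝕜).constr 𝕜 fun ν => ((s ν.degree : ℝ) : 𝕜) • x ν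
  have hΨ : ∀ ν, Ψ (monomial ν 1) = ((s ν.degree : ℝ) : 𝕜) • x ν := fun ν => by
    simpa using (basisMonomials (Fin k) 𝕜).constr_basis 𝕜
      (fun ν => ((s ν.degree : ℝ) : 𝕜) • x ν) ν
  have hΨc : ∀ ν (a : 𝕜), Ψ (monomial ν a) = (a * ((s ν.degree : ℝ) : 𝕜)) • x ν := fun ν a => by
    rw [mul_smul, ← hΨ, ← map_smul, smul_monomial, smul_eq_mul, mul_one]
  refine ⟨J, F, Ψ, hFp, fun j P => ?_, ?_⟩
  · suffices h : J.toLinearMap ∘ₗ (F j).toLinearMap ∘ₗ Ψ = Ψ ∘ₗ (pderiv j).toLinearMap from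
      LinearMap.congr_fun h P
    refine (basisMonomials (Fin k) 𝕜).ext fun μ => ?_
    simp only [coe_basisMonomials, LinearMap.comp_apply, ContinuousLinearMap.coe_coe,
      Derivation.coeFn_coe, pderiv_monomial, one_mul, hΨ, map_smul]
    have hJF := hJ (F j (x μ))
    simp only [hFe, hxf] at hJF
    by_cases hμ : μ j = 0
    · have h0 : J (F j (x μ)) = 0 := by
        refine hJF.unique ?_
        convert! (hasSum_zero : HasSum (fun _ : Fin k →₀ ℕ => (0 : X)) 0) using 2 with ν
        have hne : ν + Finsupp.single j 1 ≠ μ := fun h => by simp [← h] at hμ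
        rw [if_neg hne, mul_zero, zero_smul]
      simp [h0, hμ]
    · obtain ⟨ν, rfl⟩ : ∃ ν, μ = ν + Finsupp.single j 1 :=
        ⟨μ - Finsupp.single j 1, (tsub_add_cancel_of_le
          (Finsupp.single_le_iff.2 (Nat.one_le_iff_ne_zero.2 hμ))).symm⟩
      have h1 : J (F j (x (ν + Finsupp.single j 1))) =
          (((ν j + 1 : ℝ) * δ ν.degree : ℝ) : 𝕜) • x ν := by
        refine (hJF.unique (hasSum_single ν fun μ hμν => ?_)).trans ?_
        · rw [if_neg fun h => hμν (add_right_cancel h), mul_zero, zero_smul]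
        · rw [if_pos rfl, mul_one, smul_smul, ← RCLike.ofReal_mul]
          congr 2
          field_simp [(hB ν).ne']
      rw [h1, add_tsub_cancel_right, Finsupp.degree.map_add, Finsupp.degree_single,
        hΨc, smul_smul, ← hss ν.degree, Finsupp.add_apply, Finsupp.single_eq_same]
      congr 1
      push_cast
      ring
  · have hsub : (Submodule.span 𝕜 (Set.range x) : Set X) ⊆ Set.range Ψ := by
      rw [← LinearMap.coe_range, SetLike.coe_subset_coe, Submodule.span_le]
      rintro _ ⟨ν, rfl⟩
      refine ⟨(((s ν.degree : ℝ) : 𝕜))⁻¹ • monomial ν 1, ?_⟩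
      rw [map_smul, hΨ, inv_smul_smul₀]
      exact_mod_cast hs _
    exact hd.mono hsub

end Intertwining

/-! ### Mixing groups and dense orbits. -/

section MixingGroup

variable {𝕜 X : Type*} [RCLike 𝕜] [AddCommGroup X] [Module 𝕜 X] [UniformSpace X]
  [IsUniformAddGroup X] [ContinuousSMul 𝕜 X] [FirstCountableTopology X] [T2Space X]
  [CompleteSpace X] [TopologicalSpace.SeparableSpace X]

theorem exists_uniformlyContinuous_mixing_group [PolynormableSpace 𝕜 X]
    (hX : ¬ FiniteDimensional 𝕜 X) (hω : IsEmpty (X ≃L[𝕜] (ℕ → 𝕜))) {k : ℕ} (hk : 1 ≤ k) :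
    ∃ T : EuclideanSpace ℝ (Fin k) → X →L[𝕜] X,
      IsOperatorSemigroup T ∧ IsUniformlyContinuousFamily T ∧ IsMixingFamily T := by
  obtain ⟨p, hp, hfin⟩ : ∃ p : Seminorm 𝕜 X, Continuous p ∧ ¬ p.HasFiniteRank := by
    by_contra! h
    exact hω.elim (nonempty_equiv_pi_of_hasFiniteRank h hX).some
  obtain ⟨x, f, hxf, hf, hd⟩ := exists_biorthogonal hp hfin
  have : Nonempty (Fin k) := ⟨⟨0, hk⟩⟩
  obtain ⟨e⟩ := nonempty_equiv_of_countable (α := Fin k →₀ ℕ) (β := ℕ)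
  obtain ⟨J, F, Ψ, hF, hΨ, hdΨ⟩ := exists_factors_of_biorthogonal hp
    (x := x ∘ e) (f := f ∘ e) (fun μ ν => by simp [hxf, e.injective.eq_iff]) (fun ν => hf _)
    (by rwa [e.surjective.range_comp])
  exact ⟨expGroup J F, isOperatorSemigroup_expGroup hΨ hdΨ,
    isUniformlyContinuousFamily_expGroup J F hp hF, isMixingFamily_expGroup hΨ hdΨ⟩

theorem IsUniformlyContinuousFamily.isStronglyContinuousFamily {A : Type*} [TopologicalSpace A]
    [SequentialSpace A] {T : A → X →L[𝕜] X} (hT : IsUniformlyContinuousFamily T) :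
    IsStronglyContinuousFamily T := by
  obtain ⟨U, hU, h⟩ := hT
  intro x
  refine continuous_iff_seqContinuous.2 fun u t hut => ?_
  have hlim : Tendsto (fun c : 𝕜 => c • x) (𝓝[≠] 0) (𝓝 0) := by
    have : Continuous fun c : 𝕜 => c • x := by fun_prop
    simpa using (this.tendsto 0).mono_left nhdsWithin_le_nhds
  obtain ⟨c, hcU, hc⟩ := ((hlim.eventually_mem hU).and eventually_mem_nhdsWithin).exists
  have h1 := ((h u t hut).tendsto_at hcU).const_smul c⁻¹
  have hc' : c ≠ 0 := hc
  simpa [hc', Function.comp_def] using h1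

/-- Birkhoff transitivity: by Baire, some point lies in all the dense open sets of points whose
orbit visits a given basic open set. -/
theorem exists_denseRange_of_meets {ι : Type*} (T : ι → X →L[𝕜] X)
    (h : ∀ U V : Set X, IsOpen U → U.Nonempty → IsOpen V → V.Nonempty →
      ∃ i, (T i '' U ∩ V).Nonempty) :
    IsUniversalFamily fun i x => T i x := by
  have : (uniformity X).IsCountablyGenerated := IsUniformAddGroup.uniformity_countably_generated
  have : SecondCountableTopology X := UniformSpace.secondCountable_of_separable X
  let B := TopologicalSpace.countableBasis X
  have hB := TopologicalSpace.isBasis_countableBasis X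
  have hdense : Dense (⋂ V ∈ B, ⋃ i, T i ⁻¹' V) := by
    refine dense_biInter_of_isOpen (fun V hV => isOpen_iUnion fun i =>
      (hB.isOpen hV).preimage (T i).continuous) (TopologicalSpace.countable_countableBasis X)
      fun V hV => dense_iff_inter_open.2 fun U hU hUne => ?_
    obtain ⟨i, _, ⟨x, hx, rfl⟩, hxV⟩ := h U V hU hUne (hB.isOpen hV)
      (TopologicalSpace.nonempty_of_mem_countableBasis hV)
    exact ⟨x, hx, Set.mem_iUnion.2 ⟨i, hxV⟩⟩
  obtain ⟨x, hx⟩ := hdense.nonempty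
  refine ⟨x, hB.dense_iff.2 fun V hV _ => ?_⟩
  obtain ⟨i, hi⟩ := Set.mem_iUnion.1 (Set.mem_iInter₂.1 hx V hV)
  exact ⟨_, hi, i, rfl⟩

theorem exists_stronglyContinuous_supercyclic_semigroup {T : EuclideanSpace ℝ (Fin 1) → X →L[𝕜] X}
    (hT : IsOperatorSemigroup T) (hu : IsUniformlyContinuousFamily T) (hm : IsMixingFamily T) :
    ∃ T : NNReal → X →L[𝕜] X,
      IsOperatorSemigroup T ∧ IsStronglyContinuousFamily T ∧ IsSupercyclicFamily T := by
  let e : NNReal → EuclideanSpace ℝ (Fin 1) := fun t => EuclideanSpace.single 0 (t : ℝ)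
  have he : Continuous e := by
    refine (PiLp.continuous_toLp 2 _).comp ?_
    exact (continuous_single (A := fun _ : Fin 1 => ℝ) 0).comp NNReal.continuous_coe
  have hnorm : ∀ t, ‖e t‖ = t := fun t => by simp [e]
  refine ⟨fun t => T (e t), ⟨?_, fun s t => ?_⟩, fun x =>
    (hu.isStronglyContinuousFamily x).comp he, ?_⟩
  · rw [← hT.map_zero]
    congr 1
    ext i
    simp [e]
  · rw [← hT.map_add]
    congr 1
    ext i
    fin_cases i
    simp [e]
  · obtain ⟨x, hx⟩ := exists_denseRange_of_meets (fun t => T (e t)) fun U V hU hUne hV hVne => by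
      obtain ⟨r, hr, h⟩ := hm U V hU hUne hV hVne
      refine ⟨Real.toNNReal (r + 1), h _ ?_⟩
      rw [hnorm, Real.coe_toNNReal _ (by positivity)]
      linarith
    refine ⟨x, hx.mono ?_⟩
    rintro _ ⟨t, rfl⟩
    exact ⟨(1, t), by simp⟩

end MixingGroup

/-! ### The commutative algebra of a finite-dimensional semigroup. -/

section FiniteDimensional

variable {𝕜 : Type*} [RCLike 𝕜]

/-- A finite extension of `ℝ` is `ℝ` or `ℂ`; the degree over `𝕜` divides the degree over `ℝ`. -/
theorem finrank_field_le_two (K : Type*) [Field K] [Algebra 𝕜 K] [FiniteDimensional 𝕜 K] :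
    Module.finrank 𝕜 K ≤ 2 := by
  let _ : Algebra ℝ K := ((algebraMap 𝕜 K).comp (algebraMap ℝ 𝕜)).toAlgebra
  have : IsScalarTower ℝ 𝕜 K := IsScalarTower.of_algebraMap_eq fun _ => rfl
  have : FiniteDimensional ℝ K := FiniteDimensional.trans ℝ 𝕜 K
  have h : Module.finrank ℝ K ≤ 2 := by
    rcases Real.nonempty_algEquiv_or K with ⟨⟨e⟩⟩ | ⟨⟨e⟩⟩
    · rw [e.toLinearEquiv.finrank_eq, Module.finrank_self]
      norm_num
    · rw [e.toLinearEquiv.finrank_eq, Complex.finrank_real_complex]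
  rw [← Module.finrank_mul_finrank ℝ 𝕜 K] at h
  exact (Nat.le_mul_of_pos_left _ Module.finrank_pos).trans h

theorem finrank_domain_le_two {K : Type*} [Ring K] [IsDomain K] [Algebra 𝕜 K]
    [FiniteDimensional 𝕜 K] (h : ∀ a b : K, a * b = b * a) : Module.finrank 𝕜 K ≤ 2 := by
  let _ : CommRing K := { ‹Ring K› with mul_comm := h }
  let _ : Field K := fieldOfFiniteDimensional 𝕜 K
  exact finrank_field_le_two K

variable {V : Type*} [NormedAddCommGroup V] [NormedSpace 𝕜 V] [FiniteDimensional 𝕜 V]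

theorem ContinuousLinearMap.det_mul (A B : V →L[𝕜] V) : (A * B).det = A.det * B.det :=
  LinearMap.det_comp _ _

theorem ContinuousLinearMap.det_smul (z : 𝕜) (A : V →L[𝕜] V) :
    (z • A).det = z ^ Module.finrank 𝕜 V * A.det :=
  LinearMap.det_smul _ _

theorem ContinuousLinearMap.surjective_of_det_ne_zero {A : V →L[𝕜] V} (hA : A.det ≠ 0) :
    Function.Surjective A :=
  (LinearMap.equivOfDetNeZero (A : V →ₗ[𝕜] V) hA).surjective

variable {S : NNReal → V →L[𝕜] V}

theorem IsOperatorSemigroup.mul_comm (hS : IsOperatorSemigroup S) (s t : NNReal) :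
    S s * S t = S t * S s :=
  (hS.map_add t s).symm.trans ((congrArg S (add_comm t s)).trans (hS.map_add s t))

/-- Continuity at `S 0 = 1` makes small times invertible, and every time is a multiple of a small
one. -/
theorem IsOperatorSemigroup.det_ne_zero (hS : IsOperatorSemigroup S) (hc : Continuous S)
    (t : NNReal) : (S t).det ≠ 0 := by
  have hdet : Continuous fun s => (S s).det := ContinuousLinearMap.continuous_det.comp hc
  have h0 : (S 0).det ≠ 0 := by
    rw [hS.map_zero]
    exact (LinearMap.det_id (M := V) (A := 𝕜)).trans_ne one_ne_zero
  have hlim : Tendsto (fun m : ℕ => t / (m + 1 : ℕ)) atTop (𝓝 0) := by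
    have := (tendsto_const_div_atTop_nhds_zero_nat (t : ℝ)).comp (tendsto_add_atTop_nat 1)
    exact NNReal.tendsto_coe.1 (by simpa [Function.comp_def] using this)
  obtain ⟨m, hm⟩ := (hlim.eventually (hdet.continuousAt.eventually_ne h0)).exists
  have hpow : ∀ n : ℕ, (S (n * (t / (m + 1 : ℕ)))).det ≠ 0 := fun n => by
    induction n with
    | zero => simpa using h0
    | succ n ih =>
      have : ((n + 1 : ℕ) : NNReal) * (t / (m + 1 : ℕ)) =
          n * (t / (m + 1 : ℕ)) + t / (m + 1 : ℕ) := by push_cast; ring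
      rw [this, hS.map_add]
      exact (ContinuousLinearMap.det_mul _ _).trans_ne (mul_ne_zero hm ih)
  have := hpow (m + 1)
  rwa [mul_div_cancel₀ _ (by positivity)] at this

/-- The commutative algebra generated by an operator semigroup. -/
noncomputable def semigroupAlgebra (S : NNReal → V →L[𝕜] V) : Subalgebra 𝕜 (V →L[𝕜] V) :=
  Algebra.adjoin 𝕜 (Set.range S)

theorem mem_semigroupAlgebra (t : NNReal) : S t ∈ semigroupAlgebra S :=
  Algebra.subset_adjoin ⟨t, rfl⟩

theorem IsOperatorSemigroup.isMulCommutative (hS : IsOperatorSemigroup S) :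
    IsMulCommutative (semigroupAlgebra S) :=
  Algebra.isMulCommutative_adjoin 𝕜 (by rintro _ ⟨s, rfl⟩ _ ⟨t, rfl⟩; exact hS.mul_comm s t)

theorem IsOperatorSemigroup.mul_comm_of_mem (hS : IsOperatorSemigroup S) {A B : V →L[𝕜] V}
    (hA : A ∈ semigroupAlgebra S) (hB : B ∈ semigroupAlgebra S) : A * B = B * A := by
  have := hS.isMulCommutative
  exact congrArg Subtype.val (mul_comm' (⟨A, hA⟩ : semigroupAlgebra S) ⟨B, hB⟩)

variable {x : V}

theorem IsOperatorSemigroup.eq_zero_of_apply_eq_zero (hS : IsOperatorSemigroup S)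
    (hx : DenseRange fun p : 𝕜 × NNReal => p.1 • S p.2 x) {A : V →L[𝕜] V}
    (hA : A ∈ semigroupAlgebra S) (hAx : A x = 0) : A = 0 := by
  refine ContinuousLinearMap.coeFn_injective (hx.equalizer A.continuous continuous_zero ?_)
  funext p
  have h : A (S p.2 x) = S p.2 (A x) :=
    DFunLike.congr_fun (hS.mul_comm_of_mem hA (mem_semigroupAlgebra p.2)) x
  simp [h, hAx]

theorem exists_mem_semigroupAlgebra_apply_eq
    (hx : DenseRange fun p : 𝕜 × NNReal => p.1 • S p.2 x) (y : V) :
    ∃ A ∈ semigroupAlgebra S, A x = y := by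
  let W : Submodule 𝕜 V := (Subalgebra.toSubmodule (semigroupAlgebra S)).map
    (ContinuousLinearMap.apply 𝕜 V x).toLinearMap
  have hd : Dense (W : Set V) := hx.mono (by
    rintro _ ⟨p, rfl⟩
    exact ⟨p.1 • S p.2, Subalgebra.smul_mem _ (mem_semigroupAlgebra _) _, rfl⟩)
  have hy : y ∈ (W : Set V) := by
    rw [← W.closed_of_finiteDimensional.closure_eq]
    exact hd y
  obtain ⟨A, hA, h⟩ := hy
  exact ⟨A, hA, h⟩

/-- The supercyclic vector is both cyclic and separating for the algebra, so evaluation at `x` is a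
linear isomorphism onto `V` and carries density of the orbit back to operators. -/
theorem IsOperatorSemigroup.mem_closure (hS : IsOperatorSemigroup S)
    (hx : DenseRange fun p : 𝕜 × NNReal => p.1 • S p.2 x) {A : V →L[𝕜] V}
    (hA : A ∈ semigroupAlgebra S) :
    A ∈ closure (Set.range fun p : 𝕜 × NNReal => p.1 • S p.2) := by
  let R := Subalgebra.toSubmodule (semigroupAlgebra S)
  let ev : R →ₗ[𝕜] V := (ContinuousLinearMap.apply 𝕜 V x).toLinearMap ∘ₗ R.subtype
  have hbij : Function.Bijective ev := by
    refine ⟨(injective_iff_map_eq_zero _).2 fun B hB => ?_, fun y => ?_⟩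
    · exact Subtype.ext (hS.eq_zero_of_apply_eq_zero hx B.2 hB)
    · obtain ⟨B, hB, h⟩ := exists_mem_semigroupAlgebra_apply_eq hx y
      exact ⟨⟨B, hB⟩, h⟩
  let e := LinearEquiv.ofBijective ev hbij
  let g : V →ₗ[𝕜] (V →L[𝕜] V) := R.subtype ∘ₗ e.symm.toLinearMap
  have hg : ∀ B ∈ R, g (B x) = B := fun B hB =>
    congrArg Subtype.val (e.symm_apply_apply ⟨B, hB⟩)
  have hgc : Continuous g := g.continuous_of_finiteDimensional
  rw [← hg A hA]
  refine map_mem_closure hgc (hx (A x)) ?_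
  rintro _ ⟨p, rfl⟩
  exact ⟨p, (hg (p.1 • S p.2) (Subalgebra.smul_mem _ (mem_semigroupAlgebra _) _)).symm⟩

end FiniteDimensional

/-! ### Recurrence and the determinant bound. -/

section Boundedness

variable {𝕜 : Type*} [RCLike 𝕜] {V : Type*} [NormedAddCommGroup V] [NormedSpace 𝕜 V]
  [FiniteDimensional 𝕜 V] [Nontrivial V] {S : NNReal → V →L[𝕜] V} {x : V}

theorem ContinuousLinearMap.ne_zero_of_det_ne_zero {A : V →L[𝕜] V} (hA : A.det ≠ 0) : A ≠ 0 := by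
  rintro rfl
  refine hA ?_
  have := ContinuousLinearMap.det_smul (0 : 𝕜) (0 : V →L[𝕜] V)
  rwa [zero_smul, zero_pow Module.finrank_pos.ne', zero_mul] at this

/-- Approximate the inverse of `S 1 * A` in the algebra by some `z • S t`; then `z • (S (1 + t) *
A)` is near the identity, where the strict inequality reads `1 < 2`. Homogeneity removes `z`, and
the built-in `S 1` forces the return time to be at least 1. -/
theorem IsOperatorSemigroup.exists_return (hS : IsOperatorSemigroup S) (hc : Continuous S)
    (hx : DenseRange fun p : 𝕜 × NNReal => p.1 • S p.2 x) {A : V →L[𝕜] V}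
    (hA : A ∈ semigroupAlgebra S) (hdet : A.det ≠ 0) :
    ∃ t : NNReal, 1 ≤ t ∧ ‖S t * A‖ ^ Module.finrank 𝕜 V < 2 * ‖(S t * A).det‖ := by
  have hdet1 : (S 1 * A).det ≠ 0 := by
    rw [ContinuousLinearMap.det_mul]
    exact mul_ne_zero (hS.det_ne_zero hc 1) hdet
  obtain ⟨y, hy⟩ := ContinuousLinearMap.surjective_of_det_ne_zero hdet1 x
  obtain ⟨B, hB, rfl⟩ := exists_mem_semigroupAlgebra_apply_eq hx y
  have hSA : S 1 * A ∈ semigroupAlgebra S := mul_mem (mem_semigroupAlgebra 1) hA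
  have hone : B * (S 1 * A) = 1 := by
    rw [hS.mul_comm_of_mem hB hSA]
    refine sub_eq_zero.1 (hS.eq_zero_of_apply_eq_zero hx
      (sub_mem (mul_mem hSA hB) (one_mem _)) ?_)
    simpa [sub_eq_zero] using hy
  have hopen : IsOpen {C : V →L[𝕜] V |
      ‖C * (S 1 * A)‖ ^ Module.finrank 𝕜 V < 2 * ‖(C * (S 1 * A)).det‖} := by
    have hmul : Continuous fun C : V →L[𝕜] V => C * (S 1 * A) := by fun_prop
    exact isOpen_lt (hmul.norm.pow _)
      (continuous_const.mul (ContinuousLinearMap.continuous_det.comp hmul).norm)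
  have hBmem : B ∈ {C : V →L[𝕜] V |
      ‖C * (S 1 * A)‖ ^ Module.finrank 𝕜 V < 2 * ‖(C * (S 1 * A)).det‖} := by
    rw [Set.mem_ofPred_eq, hone, show (1 : V →L[𝕜] V).det = 1 from LinearMap.det_id, norm_one,
      norm_one]
    norm_num
  obtain ⟨_, hC, ⟨z, t⟩, rfl⟩ := mem_closure_iff.1 (hS.mem_closure hx hB) _ hopen hBmem
  refine ⟨1 + t, le_self_add, ?_⟩
  have heq : z • S t * (S 1 * A) = z • (S (1 + t) * A) := by
    rw [hS.map_add]
    rfl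
  simp only [Set.mem_ofPred_eq, heq, norm_smul, ContinuousLinearMap.det_smul, norm_mul, norm_pow,
    mul_pow] at hC
  have hz : 0 < ‖z‖ ^ Module.finrank 𝕜 V := by
    refine pow_pos (norm_pos_iff.2 fun h => ?_) _
    simp [h, Module.finrank_pos.ne'] at hC
  rw [mul_left_comm] at hC
  exact lt_of_mul_lt_mul_left hC hz.le

/-- The condition is scale invariant, so compactness of the normalized good operators bounds the
return time. -/
theorem IsOperatorSemigroup.exists_uniform_return (hS : IsOperatorSemigroup S) (hc : Continuous S)
    (hx : DenseRange fun p : 𝕜 × NNReal => p.1 • S p.2 x) :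
    ∃ T : NNReal, ∀ A ∈ semigroupAlgebra S, A ≠ 0 →
      ‖A‖ ^ Module.finrank 𝕜 V ≤ 2 * ‖A.det‖ →
      ∃ t, 1 ≤ t ∧ t ≤ T ∧ ‖S t * A‖ ^ Module.finrank 𝕜 V ≤ 2 * ‖(S t * A).det‖ := by
  have : ProperSpace (V →L[𝕜] V) := FiniteDimensional.proper 𝕜 _
  have hdc : Continuous fun A : V →L[𝕜] V => A.det := ContinuousLinearMap.continuous_det
  let K : Set (V →L[𝕜] V) := Metric.sphere 0 1 ∩ ((Subalgebra.toSubmodule (semigroupAlgebra S) :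
    Set (V →L[𝕜] V)) ∩ {A | ‖A‖ ^ Module.finrank 𝕜 V ≤ 2 * ‖A.det‖})
  have hK : IsCompact K := (isCompact_sphere _ _).inter_right
    ((Submodule.closed_of_finiteDimensional _).inter
      (isClosed_le (continuous_norm.pow _) (continuous_const.mul hdc.norm)))
  have hpoint : ∀ A : V →L[𝕜] V, ∃ t, A ∈ K → 1 ≤ t ∧
      ‖S t * A‖ ^ Module.finrank 𝕜 V < 2 * ‖(S t * A).det‖ := fun A => by
    by_cases hA : A ∈ K
    · have hdet : A.det ≠ 0 := fun h => by
        have h1 : ‖A‖ = 1 := by simpa using hA.1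
        have h2 : ‖A‖ ^ Module.finrank 𝕜 V ≤ 2 * ‖A.det‖ := hA.2.2
        rw [h, h1] at h2
        norm_num at h2
      obtain ⟨t, ht⟩ := hS.exists_return hc hx hA.2.1 hdet
      exact ⟨t, fun _ => ht⟩
    · exact ⟨0, fun h => absurd h hA⟩
  choose τ hτ using hpoint
  obtain ⟨s, hsK, hs⟩ := hK.elim_nhds_subcover
    (fun A => {B | ‖S (τ A) * B‖ ^ Module.finrank 𝕜 V < 2 * ‖(S (τ A) * B).det‖})
    (fun A hA => by
      have hmul : Continuous fun B : V →L[𝕜] V => S (τ A) * B := by fun_prop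
      exact (isOpen_lt (hmul.norm.pow _)
        (continuous_const.mul (hdc.comp hmul).norm)).mem_nhds (hτ A hA).2)
  refine ⟨s.sup τ, fun A hA hA0 hAd => ?_⟩
  have hn : 0 < ‖A‖ := norm_pos_iff.2 hA0
  have hAK : ((‖A‖ : ℝ) : 𝕜)⁻¹ • A ∈ K := by
    refine ⟨?_, Submodule.smul_mem _ _ hA, ?_⟩
    · simp [norm_smul, hn.ne']
    · simp only [Set.mem_ofPred_eq, norm_smul, ContinuousLinearMap.det_smul, norm_mul, norm_pow,
        mul_pow]
      rw [mul_left_comm]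
      gcongr
  obtain ⟨A₀, hA₀, hA₀A⟩ := Set.mem_iUnion₂.1 (hs hAK)
  refine ⟨τ A₀, (hτ A₀ (hsK A₀ hA₀)).1, Finset.le_sup hA₀, ?_⟩
  simp only [Set.mem_ofPred_eq, mul_smul_comm, norm_smul, ContinuousLinearMap.det_smul, norm_mul,
    norm_pow, mul_pow] at hA₀A
  rw [mul_left_comm] at hA₀A
  exact (lt_of_mul_lt_mul_left hA₀A (by positivity)).le

/-- Good times have gaps at most `T`, so each `S t` is a good operator times one from the compact
time interval `[0, T]`. The bound is homogeneous and closed, hence passes to the whole algebra. -/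
theorem IsOperatorSemigroup.exists_norm_pow_le_det (hS : IsOperatorSemigroup S) (hc : Continuous S)
    (hx : DenseRange fun p : 𝕜 × NNReal => p.1 • S p.2 x) :
    ∃ C : ℝ, ∀ A ∈ semigroupAlgebra S, ‖A‖ ^ Module.finrank 𝕜 V ≤ C * ‖A.det‖ := by
  obtain ⟨T, hT⟩ := hS.exists_uniform_return hc hx
  have hdc : Continuous fun A : V →L[𝕜] V => A.det := ContinuousLinearMap.continuous_det
  have hpos : ∀ t, 0 < ‖(S t).det‖ := fun t => norm_pos_iff.2 (hS.det_ne_zero hc t)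
  have hgood : ∀ N : ℕ, ∀ t : NNReal, t ≤ N → ∃ g s, t = g + s ∧ s ≤ T ∧
      ‖S g‖ ^ Module.finrank 𝕜 V ≤ 2 * ‖(S g).det‖ := fun N => by
    induction N with
    | zero =>
      intro t ht
      refine ⟨0, 0, by simpa using ht, zero_le, ?_⟩
      rw [hS.map_zero, show (ContinuousLinearMap.id 𝕜 V).det = 1 from LinearMap.det_id,
        ContinuousLinearMap.norm_id, norm_one]
      norm_num
    | succ N ih =>
      intro t ht
      obtain ⟨g, s, hgs, hsT, hg⟩ := ih (t - 1) (by
        rw [tsub_le_iff_right]; exact_mod_cast ht)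
      obtain ⟨r, hr1, hrT, hr⟩ := hT (S g) (mem_semigroupAlgebra g)
        (ContinuousLinearMap.ne_zero_of_det_ne_zero (hS.det_ne_zero hc g)) hg
      rw [show S r * S g = S (g + r) from (hS.map_add g r).symm] at hr
      have htg : t ≤ g + s + 1 := hgs ▸ le_tsub_add
      -- Advance the good time by its return time `r` if that does not overshoot; `1 ≤ r` and `s ≤
      -- T` keep the remainder at most `T`.
      by_cases hgr : g + r ≤ t
      · refine ⟨g + r, t - (g + r), (add_tsub_cancel_of_le hgr).symm, ?_, hr⟩
        rw [tsub_le_iff_right]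
        calc t ≤ g + s + 1 := htg
          _ ≤ g + T + r := by gcongr
          _ = T + (g + r) := by ring
      · have hgt : g ≤ t := by
          have : g ≤ t - 1 := hgs ▸ le_self_add
          exact this.trans tsub_le_self
        refine ⟨g, t - g, (add_tsub_cancel_of_le hgt).symm, ?_, hg⟩
        rw [tsub_le_iff_right]
        calc t ≤ g + r := (not_le.1 hgr).le
          _ ≤ g + T := by gcongr
          _ = T + g := add_comm _ _
  have hq : Continuous fun t => ‖S t‖ ^ Module.finrank 𝕜 V / ‖(S t).det‖ :=
    (hc.norm.pow _).div (hdc.comp hc).norm fun t => (hpos t).ne'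
  obtain ⟨M, hM⟩ := (isCompact_Icc (a := (0 : NNReal)) (b := T)).bddAbove_image hq.continuousOn
  have hMs : ∀ s ≤ T, ‖S s‖ ^ Module.finrank 𝕜 V ≤ M * ‖(S s).det‖ := fun s hs =>
    (div_le_iff₀ (hpos s)).1 (hM ⟨s, ⟨zero_le, hs⟩, rfl⟩)
  refine ⟨M * 2, fun A hA => ?_⟩
  have hclosed : IsClosed {A : V →L[𝕜] V | ‖A‖ ^ Module.finrank 𝕜 V ≤ M * 2 * ‖A.det‖} :=
    isClosed_le (continuous_norm.pow _) (continuous_const.mul hdc.norm)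
  refine closure_minimal ?_ hclosed (hS.mem_closure hx hA)
  rintro _ ⟨⟨z, t⟩, rfl⟩
  obtain ⟨N, hN⟩ := exists_nat_ge t
  obtain ⟨g, s, rfl, hsT, hg⟩ := hgood N t hN
  simp only [Set.mem_ofPred_eq, norm_smul, ContinuousLinearMap.det_smul, norm_mul, norm_pow, mul_pow]
  rw [mul_left_comm]
  gcongr
  rw [hS.map_add]
  calc ‖(S s).comp (S g)‖ ^ Module.finrank 𝕜 V
      ≤ ‖S s‖ ^ Module.finrank 𝕜 V * ‖S g‖ ^ Module.finrank 𝕜 V := by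
        rw [← mul_pow]
        gcongr
        exact ContinuousLinearMap.opNorm_comp_le _ _
    _ ≤ (M * ‖(S s).det‖) * (2 * ‖(S g).det‖) := by
        gcongr
        · exact (by positivity : (0 : ℝ) ≤ ‖S s‖ ^ Module.finrank 𝕜 V).trans (hMs s hsT)
        · exact hMs s hsT
    _ = M * 2 * ‖((S s).comp (S g)).det‖ := by
        rw [show ((S s).comp (S g)).det = (S s).det * (S g).det from
          ContinuousLinearMap.det_mul _ _, norm_mul]
        ring

end Boundedness

/-! ### Supercyclic semigroups in finite dimension. -/

section Supercyclic

variable {𝕜 : Type*} [RCLike 𝕜] {V : Type*} [NormedAddCommGroup V] [NormedSpace 𝕜 V]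
  [FiniteDimensional 𝕜 V] {S : NNReal → V →L[𝕜] V}

/-- The determinant bound makes nonzero elements of the algebra invertible, so it is a domain;
evaluation at `x` maps it onto `V`. -/
theorem IsSupercyclicFamily.finrank_le_two (hs : IsSupercyclicFamily S)
    (hS : IsOperatorSemigroup S) (hc : IsStronglyContinuousFamily S) :
    Module.finrank 𝕜 V ≤ 2 := by
  obtain ⟨x, hx⟩ := hs
  rcases subsingleton_or_nontrivial V with hV | hV
  · simp [Module.finrank_zero_of_subsingleton]
  obtain ⟨C, hC⟩ := hS.exists_norm_pow_le_det (continuous_clm_apply.2 hc) hx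
  have hdet : ∀ A ∈ semigroupAlgebra S, A ≠ 0 → A.det ≠ 0 := fun A hA hA0 h => by
    have := hC A hA
    rw [h, norm_zero, mul_zero] at this
    exact (pow_pos (norm_pos_iff.2 hA0) _).not_ge this
  have : IsDomain (semigroupAlgebra S) := by
    have : NoZeroDivisors (semigroupAlgebra S) := ⟨fun {A B} hAB => by
      by_contra! h
      have h1 := hdet A A.2 fun h0 => h.1 (Subtype.ext h0)
      have h2 := hdet B B.2 fun h0 => h.2 (Subtype.ext h0)
      refine ContinuousLinearMap.ne_zero_of_det_ne_zero (A := A.1 * B.1) ?_ (congrArg Subtype.val hAB)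
      rw [ContinuousLinearMap.det_mul]
      exact mul_ne_zero h1 h2⟩
    exact NoZeroDivisors.to_isDomain _
  refine le_trans ?_ (finrank_domain_le_two (𝕜 := 𝕜) (K := semigroupAlgebra S)
    fun A B => Subtype.ext (hS.mul_comm_of_mem A.2 B.2))
  let ev : semigroupAlgebra S →ₗ[𝕜] V :=
    (ContinuousLinearMap.apply 𝕜 V x).toLinearMap ∘ₗ (semigroupAlgebra S).val.toLinearMap
  refine LinearMap.finrank_le_finrank_of_surjective (f := ev) fun y => ?_
  obtain ⟨B, hB, h⟩ := exists_mem_semigroupAlgebra_apply_eq hx y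
  exact ⟨⟨B, hB⟩, h⟩

end Supercyclic

/-! ### Invariant spaces of functionals on `ω`. -/

section InvariantFunctionals

variable {𝕜 X : Type*} [RCLike 𝕜] [AddCommGroup X] [Module 𝕜 X] [UniformSpace X]
  [IsUniformAddGroup X] [ContinuousSMul 𝕜 X]

theorem finiteDimensional_of_forall_vanish (φ : X ≃L[𝕜] (ℕ → 𝕜)) (I : Finset ℕ)
    {W : Submodule 𝕜 (X →L[𝕜] 𝕜)} (hW : ∀ g ∈ W, ∀ x, (∀ i ∈ I, φ x i = 0) → g x = 0) :
    FiniteDimensional 𝕜 W := by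
  let E : W →ₗ[𝕜] (I → 𝕜) :=
    { toFun := fun g i => g.1 (φ.symm (Pi.single i.1 1))
      map_add' := fun _ _ => rfl
      map_smul' := fun _ _ => rfl }
  refine FiniteDimensional.of_injective E ((injective_iff_map_eq_zero _).2 fun g hg => ?_)
  refine Subtype.ext (ContinuousLinearMap.ext fun x => ?_)
  have h1 := hW g.1 g.2 (x - ∑ i ∈ I, φ x i • φ.symm (Pi.single i 1)) fun j hj => by
    simp [Finset.sum_apply, Pi.single_apply, hj]
  rw [map_sub, map_sum, sub_eq_zero] at h1
  rw [h1]
  refine Finset.sum_eq_zero fun i hi => ?_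
  have h2 : g.1 (φ.symm (Pi.single i 1)) = 0 := congrFun hg ⟨i, hi⟩
  rw [map_smul, h2, smul_zero]

theorem exists_finset_vanish (φ : X ≃L[𝕜] (ℕ → 𝕜)) {U : Set X} (hU : U ∈ 𝓝 (0 : X)) :
    ∃ I : Finset ℕ, ∀ x, (∀ i ∈ I, φ x i = 0) → x ∈ U := by
  have hV : φ.symm ⁻¹' U ∈ 𝓝 (0 : ℕ → 𝕜) :=
    φ.symm.continuous.continuousAt (by simpa using hU)
  rw [nhds_pi, Filter.mem_pi] at hV
  obtain ⟨I, hI, t, ht, h⟩ := hV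
  refine ⟨hI.toFinset, fun x hx => ?_⟩
  have : φ x ∈ φ.symm ⁻¹' U := h fun i hi => by
    rw [hx i (hI.mem_toFinset.2 hi)]
    exact mem_of_mem_nhds (ht i)
  simpa using this

variable {T : NNReal → X →L[𝕜] X}

/-- Banach–Steinhaus bounds all `f ∘ T t`, `t ≤ 1`, on one neighbourhood of zero. In `ω` it contains
a coordinate subspace of finite codimension, and a functional bounded on a subspace vanishes there.
-/
theorem IsStronglyContinuousFamily.exists_finset_vanish [BaireSpace X] (φ : X ≃L[𝕜] (ℕ → 𝕜))
    (hc : IsStronglyContinuousFamily T) (f : X →L[𝕜] 𝕜) :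
    ∃ I : Finset ℕ, ∀ x, (∀ i ∈ I, φ x i = 0) → ∀ t ≤ 1, f (T t x) = 0 := by
  let 𝓕 : Set.Icc (0 : NNReal) 1 → X →L[𝕜] 𝕜 := fun t => f.comp (T t)
  have hequi : UniformEquicontinuous ((↑) ∘ 𝓕) := by
    refine (norm_withSeminorms 𝕜 𝕜).banach_steinhaus fun _ x => ?_
    have hcont : Continuous fun t : NNReal => ‖f (T t x)‖ := (f.continuous.comp (hc x)).norm
    obtain ⟨M, hM⟩ := (isCompact_Icc (a := (0 : NNReal)) (b := 1)).bddAbove_image hcont.continuousOn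
    refine ⟨M, ?_⟩
    rintro _ ⟨t, rfl⟩
    exact hM ⟨t, t.2, rfl⟩
  have hU := hequi.equicontinuous 0 _ (Metric.dist_mem_uniformity one_pos)
  obtain ⟨I, hI⟩ := _root_.exists_finset_vanish φ hU
  refine ⟨I, fun x hx t ht => ?_⟩
  by_contra hne
  have h1 := hI ((f (T t x))⁻¹ • x) (fun i hi => by simp [hx i hi]) ⟨t, zero_le, ht⟩
  simp [𝓕, hne] at h1

theorem exists_finiteDimensional_invariant [BaireSpace X] (φ : X ≃L[𝕜] (ℕ → 𝕜))
    (hT : IsOperatorSemigroup T) (hc : IsStronglyContinuousFamily T) (f : X →L[𝕜] 𝕜) :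
    ∃ L : Submodule 𝕜 (X →L[𝕜] 𝕜), FiniteDimensional 𝕜 L ∧ f ∈ L ∧
      ∀ t, ∀ g ∈ L, g.comp (T t) ∈ L := by
  let L : NNReal → Submodule 𝕜 (X →L[𝕜] 𝕜) := fun s =>
    Submodule.span 𝕜 ((fun t => f.comp (T t)) '' Set.Iic s)
  have hmono : Monotone L := fun s t hst =>
    Submodule.span_mono (Set.image_mono (Set.Iic_subset_Iic.2 hst))
  obtain ⟨I, hI⟩ := hc.exists_finset_vanish φ f
  have hfin1 : FiniteDimensional 𝕜 (L 1) := by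
    refine finiteDimensional_of_forall_vanish φ I fun g hg x hx => ?_
    induction hg using Submodule.span_induction with
    | mem g hg =>
      obtain ⟨t, ht, rfl⟩ := hg
      exact hI x hx t ht
    | zero => rfl
    | add g h _ _ h1 h2 => simp [h1, h2]
    | smul c g _ h1 => simp [h1]
  have hfin : ∀ s ≤ 1, FiniteDimensional 𝕜 (L s) := fun s hs =>
    Submodule.finiteDimensional_of_le (hmono hs)
  classical
  -- Choose `s₀` with the span over `[0, s₀]` of least dimension: halving `s₀` leaves it unchanged,
  -- so times up to `s₀ / 2` preserve it, and then all times do.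
  have hex : ∃ n, ∃ s, 0 < s ∧ s ≤ 1 ∧ Module.finrank 𝕜 (L s) = n := ⟨_, 1, one_pos, le_rfl, rfl⟩
  obtain ⟨s₀, hs₀, hs₀1, hs₀n⟩ := Nat.find_spec hex
  have hhalf : L (s₀ / 2) = L s₀ := by
    have h1 : s₀ / 2 ≤ s₀ := half_le_self hs₀.le
    have := hfin s₀ hs₀1
    refine Submodule.eq_of_le_of_finrank_le (hmono h1) ?_
    rw [hs₀n]
    exact Nat.find_min' hex ⟨_, half_pos hs₀, h1.trans hs₀1, rfl⟩
  have hsmall : ∀ t ≤ s₀ / 2, ∀ g ∈ L s₀, g.comp (T t) ∈ L s₀ := fun t ht g hg => by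
    rw [← hhalf] at hg
    induction hg using Submodule.span_induction with
    | mem g hg =>
      obtain ⟨r, hr, rfl⟩ := hg
      refine Submodule.subset_span ⟨t + r, ?_, ?_⟩
      · exact (add_le_add ht hr).trans_eq (add_halves s₀)
      · simp only [hT.map_add]
        rfl
    | zero => simp
    | add g h _ _ h1 h2 => simpa [ContinuousLinearMap.add_comp] using add_mem h1 h2
    | smul c g _ h1 => simpa [ContinuousLinearMap.smul_comp] using Submodule.smul_mem _ c h1
  refine ⟨L s₀, hfin s₀ hs₀1, Submodule.subset_span ⟨0, Set.mem_Iic.2 zero_le, ?_⟩, fun t => ?_⟩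
  · simp [hT.map_zero]
  have hmul : ∀ n : ℕ, ∀ t ≤ n * (s₀ / 2), ∀ g ∈ L s₀, g.comp (T t) ∈ L s₀ := fun n => by
    induction n with
    | zero =>
      intro t ht g hg
      have ht0 : t = 0 := by simpa using ht
      rw [ht0, hT.map_zero]
      simpa using hg
    | succ n ih =>
      intro t ht g hg
      have h1 : t - s₀ / 2 ≤ n * (s₀ / 2) := by
        rw [tsub_le_iff_right]
        refine ht.trans_eq ?_
        push_cast
        ring
      by_cases h2 : s₀ / 2 ≤ t
      · rw [← tsub_add_cancel_of_le h2, hT.map_add, ← ContinuousLinearMap.comp_assoc]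
        exact ih _ h1 _ (hsmall _ le_rfl _ hg)
      · exact hsmall _ (not_le.1 h2).le _ hg
  obtain ⟨n, hn⟩ := Archimedean.arch t (half_pos hs₀)
  exact hmul n t (by simpa using hn)

end InvariantFunctionals

/-! ### Excluding supercyclicity on `ω`. -/

section NotSupercyclic

variable {𝕜 X : Type*} [RCLike 𝕜] [AddCommGroup X] [Module 𝕜 X] [UniformSpace X]
  [IsUniformAddGroup X] [ContinuousSMul 𝕜 X] {T : NNReal → X →L[𝕜] X}

theorem exists_linearIndependent_span_eq {E : Type*} [AddCommGroup E] [Module 𝕜 E]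
    (L : Submodule 𝕜 E) [FiniteDimensional 𝕜 L] :
    ∃ g : Fin (Module.finrank 𝕜 L) → E,
      LinearIndependent 𝕜 g ∧ Submodule.span 𝕜 (Set.range g) = L := by
  let b := Module.finBasis 𝕜 L
  refine ⟨fun i => b i, b.linearIndependent.map' L.subtype L.ker_subtype, ?_⟩
  rw [show (fun i => (b i : E)) = L.subtype ∘ b from rfl, Set.range_comp, ← Submodule.map_span,
    b.span_eq, Submodule.map_subtype_top]

/-- Invariance of the span lets the semigroup descend to the quotient by the common kernel, which is
`𝕜^n`; supercyclicity and strong continuity descend with it. -/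
theorem card_invariant_functionals_le_two (hT : IsOperatorSemigroup T)
    (hc : IsStronglyContinuousFamily T) (hs : IsSupercyclicFamily T)
    {n : ℕ} {b : Fin n → X →L[𝕜] 𝕜} (hb : LinearIndependent 𝕜 b)
    (hL : ∀ t i, (b i).comp (T t) ∈ Submodule.span 𝕜 (Set.range b)) : n ≤ 2 := by
  let π : X →L[𝕜] (Fin n → 𝕜) := ContinuousLinearMap.pi b
  have hli : LinearIndependent 𝕜 fun i => (b i : X →ₗ[𝕜] 𝕜) :=
    hb.map' (ContinuousLinearMap.coeLM 𝕜) (LinearMap.ker_eq_bot.2 ContinuousLinearMap.coe_injective)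
  have hsurj : Function.Surjective π := fun a => by
    obtain ⟨y, hy⟩ := exists_forall_apply_eq_of_linearIndependent hli a
    exact ⟨y, funext hy⟩
  have hker : ∀ x, π x = 0 → ∀ g ∈ Submodule.span 𝕜 (Set.range b), g x = 0 := fun x hx g hg => by
    induction hg using Submodule.span_induction with
    | mem g hg =>
      obtain ⟨i, rfl⟩ := hg
      exact congrFun hx i
    | zero => rfl
    | add g h _ _ h1 h2 => simp [h1, h2]
    | smul c g _ h1 => simp [h1]
  obtain ⟨σ, hσ⟩ := LinearMap.exists_rightInverse_of_surjective (π : X →ₗ[𝕜] (Fin n → 𝕜))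
    (LinearMap.range_eq_top.2 hsurj)
  have hσ' : ∀ v, π (σ v) = v := LinearMap.congr_fun hσ
  let S : NNReal → (Fin n → 𝕜) →L[𝕜] (Fin n → 𝕜) := fun t =>
    LinearMap.toContinuousLinearMap ((π : X →ₗ[𝕜] (Fin n → 𝕜)) ∘ₗ (T t : X →ₗ[𝕜] X) ∘ₗ σ)
  have hSdef : ∀ t v, S t v = π (T t (σ v)) := fun t v => rfl
  have hSπ : ∀ t x, S t (π x) = π (T t x) := fun t x => by
    rw [hSdef, ← sub_eq_zero, ← map_sub, ← map_sub]
    refine funext fun i => ?_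
    exact hker (σ (π x) - x) (by rw [map_sub, hσ', sub_self]) _ (hL t i)
  have hS : IsOperatorSemigroup S := by
    refine ⟨ContinuousLinearMap.ext fun v => ?_, fun s t => ContinuousLinearMap.ext fun v => ?_⟩
    · obtain ⟨x, rfl⟩ := hsurj v
      rw [hSπ, hT.map_zero]
      rfl
    · obtain ⟨x, rfl⟩ := hsurj v
      rw [hSπ, hT.map_add, ContinuousLinearMap.comp_apply, ContinuousLinearMap.comp_apply, hSπ, hSπ]
  have hSc : IsStronglyContinuousFamily S := fun v => by
    exact π.continuous.comp (hc (σ v))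
  have hSs : IsSupercyclicFamily S := by
    obtain ⟨x, hx⟩ := hs
    refine ⟨π x, ?_⟩
    have h1 : DenseRange (π ∘ fun p : 𝕜 × NNReal => p.1 • T p.2 x) :=
      hsurj.denseRange.comp hx π.continuous
    refine h1.mono ?_
    rintro _ ⟨p, rfl⟩
    exact ⟨p, by simp [hSπ]⟩
  simpa using hSs.finrank_le_two hS hSc

theorem not_supercyclic_of_equiv_pi [BaireSpace X] (φ : X ≃L[𝕜] (ℕ → 𝕜))
    (hT : IsOperatorSemigroup T) (hc : IsStronglyContinuousFamily T) :
    ¬ IsSupercyclicFamily T := by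
  intro hs
  -- Three coordinates are one more than the dimension bound allows.
  let f : Fin 3 → X →L[𝕜] 𝕜 := fun i =>
    (ContinuousLinearMap.proj (R := 𝕜) (φ := fun _ : ℕ => 𝕜) i.1).comp (φ : X →L[𝕜] (ℕ → 𝕜))
  choose L hfin hfL hinv using fun i => exists_finiteDimensional_invariant φ hT hc (f i)
  have hinv' : ∀ t, ∀ g ∈ ⨆ i, L i, g.comp (T t) ∈ ⨆ i, L i := fun t g hg => by
    induction hg using Submodule.iSup_induction' with
    | mem i g hg => exact Submodule.mem_iSup_of_mem i (hinv i t g hg)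
    | zero => simp
    | add g h _ _ h1 h2 => simpa [ContinuousLinearMap.add_comp] using add_mem h1 h2
  obtain ⟨b, hb, hspan⟩ := exists_linearIndependent_span_eq (⨆ i, L i)
  have hle := card_invariant_functionals_le_two hT hc hs hb fun t i => by
    rw [hspan]
    exact hinv' t _ (hspan ▸ Submodule.subset_span ⟨i, rfl⟩)
  have hf : LinearIndependent 𝕜 f := by
    refine Fintype.linearIndependent_iff.2 fun c hc0 i => ?_
    have := DFunLike.congr_fun hc0 (φ.symm (Pi.single i.1 1))
    simpa [f, sum_apply, Pi.single_apply, Fin.val_inj] using this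
  have h3 := (finrank_span_eq_card hf).symm.trans_le
    (Submodule.finrank_mono (Submodule.span_le.2 (by
      rintro _ ⟨i, rfl⟩
      exact Submodule.mem_iSup_of_mem i (hfL i)) : Submodule.span 𝕜 (Set.range f) ≤ ⨆ i, L i))
  rw [Fintype.card_fin] at h3
  omega

end NotSupercyclic

theorem mainTheorem3 {𝕜 X : Type*} [RCLike 𝕜] [AddCommGroup X] [Module 𝕜 X]
    [Module ℝ X] [IsScalarTower ℝ 𝕜 X]
    [UniformSpace X] [IsUniformAddGroup X] [ContinuousSMul 𝕜 X]
    [TopologicalSpace.MetrizableSpace X] [CompleteSpace X] [LocallyConvexSpace ℝ X]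
    [TopologicalSpace.SeparableSpace X] (hX : ¬ FiniteDimensional 𝕜 X) :
    List.TFAE [
      ∀ k : ℕ, 1 ≤ k → ∃ T : EuclideanSpace ℝ (Fin k) → X →L[𝕜] X,
        IsOperatorSemigroup T ∧ IsUniformlyContinuousFamily T ∧ IsMixingFamily T,
      ∃ T : NNReal → X →L[𝕜] X,
        IsOperatorSemigroup T ∧ IsStronglyContinuousFamily T ∧ IsSupercyclicFamily T,
      IsEmpty (X ≃L[𝕜] (ℕ → 𝕜))] := by
  have : PolynormableSpace 𝕜 X := polynormableSpace_of_locallyConvexSpace_real 𝕜 X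
  have : (uniformity X).IsCountablyGenerated := IsUniformAddGroup.uniformity_countably_generated
  tfae_have 1 → 2
  | h => by
    obtain ⟨T, hT, hu, hm⟩ := h 1 le_rfl
    exact exists_stronglyContinuous_supercyclic_semigroup hT hu hm
  tfae_have 2 → 3
  | ⟨T, hT, hc, hs⟩ => ⟨fun φ => not_supercyclic_of_equiv_pi φ hT hc hs⟩
  tfae_have 3 → 1
  | hω, k, hk => exists_uniformlyContinuous_mixing_group hX hω hk
  tfae_finish
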